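/- Let $p$ be a prime, $k$ an algebraically closed field of characteristic $p$, and $G$ a finite group. All $kG$-modules are finitely generated, and $\otimes=\otimes_k$ carries the diagonal action. A component of a module is an indecomposable direct summand; a vertex of an indecomposable module $M$ is a subgroup $H\le G$ minimal such that $M$ is a direct summand of $\mathrm{Ind}_H^G\mathrm{Res}^G_H M$; a Sylow-vertex component is one having a Sylow $p$-subgroup of $G$ as vertex. A $p$-permutation module is a direct summand of a permutation module $k[X]$ ($X$ a finite $G$-set), and $M$ is an endo-$p$-permutation module if $\mathrm{End}_k(M)$ is a $p$-permutation module. A Dade module is a $kG$-module $M$ such that $\mathrm{End}_k(M)\cong k^n\oplus W$ for some $n\ge 0$ and some $p$-permutation module $W$ without Sylow-vertex components. It is capped if it has a Sylow-vertex component. Two capped Dade modules $M,N$ are compatible if $M\oplus N$ is a Dade module. Let $V(\mathcal F_G)=\bigoplus_{[Q]}k[G/Q]$, where $[Q]$ runs over the conjugacy classes of non-Sylow $p$-subgroups of $G$. An endo-$p$-permutation module $M$ is strongly capped if $\mathrm{End}_k(M)\cong k\oplus W$ where $W$ is a direct summand of $V(\mathcal F_G)\otimes N$ for some $kG$-module $N$.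 The cap of $M$ is its Sylow-vertex component, which is unique up to isomorphism. **Theorem.** (1) Compatibility is an equivalence relation on capped Dade $kG$-modules, the tensor product of two capped Dade modules is capped Dade, and $[M]+[N]:=[M\otimes N]$ is a well-defined operation making the set of equivalence classes $D(G)$ an abelian group. (2) Having isomorphic caps is an equivalence relation on strongly capped endo-$p$-permutation $kG$-modules, the tensor product of two such modules is again one, and $[M]+[N]:=[M\otimes N]$ is a well-defined operation making the set of equivalence classes (Lassueur's Dade group) an abelian group. (3) The two groups are isomorphic. -/

import Mathlib

universe u v w w'

namespace DadeModules

open Representation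

noncomputable section

section Basics

variable {k : Type u} [Field k] {G : Type v} [Group G]
  {V : Type w} [AddCommGroup V] [Module k V] {W : Type w'} [AddCommGroup W] [Module k W]

/-- `σ ∣ ρ`: the representation `σ` is isomorphic to a direct summand of `ρ`, that is, there are
equivariant maps `i : σ → ρ` and `r : ρ → σ` with `r ∘ i = id`. -/
def IsSummand (σ : Representation k G W) (ρ : Representation k G V) : Prop :=
  ∃ (i : σ.IntertwiningMap ρ) (r : ρ.IntertwiningMap σ), ∀ x : W, r (i x) = x

/-- A representation is indecomposable if it is nonzero and is not the internal direct sum of two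
nonzero subrepresentations. -/
def IsIndecomposable (ρ : Representation k G V) : Prop :=
  Nontrivial V ∧ ∀ A B : Subrepresentation ρ, IsCompl A B → A = ⊥ ∨ B = ⊥

/-- `U` is a component of `ρ`: an indecomposable direct summand. -/
def IsComponent (σ : Representation k G W) (ρ : Representation k G V) : Prop :=
  IsIndecomposable σ ∧ IsSummand σ ρ

/-- `ρ` is a direct summand of `Ind_H^G Res^G_H ρ`. -/
def IsRelProjective (H : Subgroup G) (ρ : Representation k G V) : Prop :=
  IsSummand ρ (Representation.ind H.subtype (ρ.comp H.subtype))

/-- `H` is a vertex of the (indecomposable) representation `ρ`: it is minimal among the subgroups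
such that `ρ` is a direct summand of `Ind_H^G Res^G_H ρ`. -/
def IsVertex (H : Subgroup G) (ρ : Representation k G V) : Prop :=
  Minimal (fun K : Subgroup G => IsRelProjective K ρ) H

/-- `ρ` has a Sylow `p`-subgroup of `G` as a vertex. -/
def HasSylowVertex (p : ℕ) (ρ : Representation k G V) : Prop :=
  ∃ P : Sylow p G, IsVertex (P : Subgroup G) ρ

/-- `p`-permutation modules: direct summands of a permutation module `k[X]`, `X` a finite
`G`-set. -/
def IsPPermutation (ρ : Representation k G V) : Prop :=
  ∃ (X : Type) (_ : Finite X) (_ : MulAction G X),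
    IsSummand ρ (Representation.ofMulAction k G X)

/-- `ρ` is an endo-`p`-permutation module: `End_k(ρ)` is a `p`-permutation module. -/
def IsEndoPPermutation (ρ : Representation k G V) : Prop :=
  IsPPermutation (Representation.linHom ρ ρ)

/-- `ρ` has no component with Sylow vertex. -/
def NoSylowVertexComponent (p : ℕ) (ρ : Representation k G V) : Prop :=
  ∀ U : Rep.{w} k G, IsComponent U.ρ ρ → ¬ HasSylowVertex p U.ρ

/-- `ρ` has a component with Sylow vertex. -/
def HasSylowVertexComponent (p : ℕ) (ρ : Representation k G V) : Prop :=
  ∃ U : Rep.{w} k G, IsComponent U.ρ ρ ∧ HasSylowVertex p U.ρ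

end Basics

/-! Every finitely generated `kG`-module is isomorphic to one whose underlying type lives in the
universe of `k`, so from here on modules are taken there. -/

section Dade

variable {k : Type u} [Field k] {G : Type v} [Group G]
  {V : Type u} [AddCommGroup V] [Module k V]

/-- Dade modules: `End_k(ρ) ≅ kⁿ ⊕ W` for some `n ≥ 0` and some `p`-permutation module `W` all of
whose components have non-Sylow vertices. -/
def IsDade (p : ℕ) (ρ : Representation k G V) : Prop :=
  ∃ (n : ℕ) (W : Rep.{u} k G), IsPPermutation W.ρ ∧ NoSylowVertexComponent p W.ρ ∧
    Nonempty ((Representation.linHom ρ ρ).Equiv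
      ((Representation.trivial k G (Fin n → k)).prod W.ρ))

/-- A Dade module is capped if it has a component with Sylow vertex. -/
def IsCappedDade (p : ℕ) (ρ : Representation k G V) : Prop :=
  IsDade p ρ ∧ HasSylowVertexComponent p ρ

/-- `ρ` is projective relative to `τ`: it is a direct summand of `τ ⊗ N` for some finitely
generated module `N`. -/
def IsProjectiveRelTo {T : Type w} [AddCommGroup T] [Module k T]
    (τ : Representation k G T) (ρ : Representation k G V) : Prop :=
  ∃ N : Rep.{u} k G, Module.Finite k N ∧ IsSummand ρ (τ.tprod N.ρ)

/-- `ρ` is endotrivial relative to `τ`: `End_k(ρ) ≅ k ⊕ W` with `W` projective relative to `τ`. -/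
def IsEndotrivialRelTo {T : Type w} [AddCommGroup T] [Module k T]
    (τ : Representation k G T) (ρ : Representation k G V) : Prop :=
  ∃ W : Rep.{u} k G, IsProjectiveRelTo τ W.ρ ∧
    Nonempty ((Representation.linHom ρ ρ).Equiv ((Representation.trivial k G k).prod W.ρ))

end Dade

section Family

/-- The family `ℱ_G` of all non-Sylow `p`-subgroups of `G`. -/
def NonSylow (p : ℕ) (G : Type v) [Group G] : Type v :=
  {Q : Subgroup G // IsPGroup p Q ∧ ∀ P : Sylow p G, (P : Subgroup G) ≠ Q}

/-- Conjugacy in `G` of two members of `ℱ_G`. -/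
def nonSylowConj (p : ℕ) (G : Type v) [Group G] : Setoid (NonSylow p G) where
  r Q R := ∃ g : G, Q.1.map (MulAut.conj g).toMonoidHom = R.1
  iseqv :=
    { refl := fun Q => ⟨1, by ext x; simp⟩
      symm := by
        rintro Q R ⟨g, hg⟩
        refine ⟨g⁻¹, ?_⟩
        rw [← hg, Subgroup.map_map]
        ext x
        simp [Subgroup.mem_map, mul_assoc]
      trans := by
        rintro Q R S ⟨g, hg⟩ ⟨h, hh⟩
        refine ⟨h * g, ?_⟩
        rw [← hh, ← hg, Subgroup.map_map]
        ext x
        simp [Subgroup.mem_map, mul_assoc] }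

/-- The permutation module `V(ℱ_G) = ⨁_{[Q] ∈ ℱ_G/G} k[G/Q]`, the sum running over the conjugacy
classes of non-Sylow `p`-subgroups. -/
def VF (p : ℕ) (k : Type u) [Field k] (G : Type v) [Group G] :
    Representation k G (DirectSum (Quotient (nonSylowConj p G))
      (fun c => MonoidAlgebra k (G ⧸ (Quotient.out c).1))) :=
  Representation.directSum
    (fun c : Quotient (nonSylowConj p G) =>
      Representation.ofMulAction k G (G ⧸ (Quotient.out c).1))

end Family

section Groups

variable (p : ℕ) (k : Type u) [Field k] (G : Type v) [Group G]

/-- Strongly capped modules: endo-`p`-permutation modules that are endotrivial relative to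
`V(ℱ_G)`. -/
def IsStronglyCapped {V : Type u} [AddCommGroup V] [Module k V] (ρ : Representation k G V) : Prop :=
  IsEndoPPermutation ρ ∧ IsEndotrivialRelTo (VF p k G) ρ

/-- A finitely generated capped Dade `kG`-module. -/
structure CappedDadeModule where
  toRep : Rep.{u} k G
  finite : Module.Finite k toRep
  isCappedDade : IsCappedDade p toRep.ρ

/-- A finitely generated strongly capped endo-`p`-permutation `kG`-module. -/
structure StronglyCappedModule where
  toRep : Rep.{u} k G
  finite : Module.Finite k toRep
  isStronglyCapped : IsStronglyCapped p k G toRep.ρ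

variable {p k G}

/-- `M` and `N` are compatible if `M ⊕ N` is a Dade module. -/
def Compatible (M N : CappedDadeModule p k G) : Prop :=
  IsDade p (M.toRep.ρ.prod N.toRep.ρ)

/-- `M` and `N` have isomorphic caps, the cap of a strongly capped module being its indecomposable
summand whose vertex is a Sylow `p`-subgroup. -/
def SameCap (M N : StronglyCappedModule p k G) : Prop :=
  ∃ M₀ N₀ : Rep.{u} k G,
    (IsComponent M₀.ρ M.toRep.ρ ∧ HasSylowVertex p M₀.ρ) ∧
    (IsComponent N₀.ρ N.toRep.ρ ∧ HasSylowVertex p N₀.ρ) ∧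
    Nonempty (M₀.ρ.Equiv N₀.ρ)

/-- The tensor product of two capped Dade modules, given that it is again capped Dade. -/
def CappedDadeModule.tensor (M N : CappedDadeModule p k G)
    (h : IsCappedDade p (M.toRep.ρ.tprod N.toRep.ρ)) : CappedDadeModule p k G where
  toRep := Rep.of (M.toRep.ρ.tprod N.toRep.ρ)
  finite := by
    have := M.finite
    have := N.finite
    exact inferInstanceAs (Module.Finite k (TensorProduct k M.toRep N.toRep))
  isCappedDade := h

/-- The tensor product of two strongly capped modules, given that it is again strongly capped. -/
def StronglyCappedModule.tensor (M N : StronglyCappedModule p k G)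
    (h : IsStronglyCapped p k G (M.toRep.ρ.tprod N.toRep.ρ)) : StronglyCappedModule p k G where
  toRep := Rep.of (M.toRep.ρ.tprod N.toRep.ρ)
  finite := by
    have := M.finite
    have := N.finite
    exact inferInstanceAs (Module.Finite k (TensorProduct k M.toRep N.toRep))
  isStronglyCapped := h

end Groups

end

end DadeModules

/-! Call a module good if it is a summand of `k[Z]` for a finite `G`-set `Z` whose stabilizers are
`G` or non-Sylow `p`-subgroups, and trace-projective if its identity is a sum of relative traces
from non-Sylow `p`-subgroups. By Higman's criterion, having no Sylow-vertex component is
trace-projectivity (`noSylowVertexComponent_iff`), and so is projectivity relative to `V(ℱ_G)`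
(`isProjectiveRelTo_VF_iff`). Hence `M` is Dade iff `End(M)` is good, capped iff moreover `M` is not
trace-projective, and capped `M`, `N` are compatible iff `Hom(M, N)` is good. Goodness passes to
summands, sums, tensor products and duals, which makes most closure statements formal.

The main lemma is `IsGood.isTraceProjective`: a good module whose invariant vectors are killed by
all invariant linear forms is trace-projective. Invariant forms on `Hom(M, N)` are trace pairings
with equivariant maps `N → M` (`exists_trace_eq`), and over algebraically closed `k` an equivariant
endomorphism of an indecomposable module is scalar plus nilpotent. So for a cap `U` of a capped Dade
module: `dim U` is nonzero in `k`, `End(U)` is `k` plus a trace-projective module, and two caps with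
good `Hom` between them are isomorphic.

Invertibility of `dim U` makes `Hom(M, L)` a summand of `Hom(U, L) ⊗ Hom(M, U)`, giving transitivity
of compatibility, and keeps tensor products capped. Inverses are duals, because `M* ⊗ M ≅ End(M)` is
good. Finally, a capped Dade module is compatible with its cap, which is strongly capped, and
strongly capped modules have isomorphic caps iff they are compatible (`sameCap_iff`); this
identifies the two sets of classes. -/

namespace DadeModules

open Representation TensorProduct

noncomputable section

/-! ### Direct summands, Hom-modules and tensor products -/

section Summands

variable {k : Type*} [Field k] {G : Type*} [Group G]
  {U V W X Y : Type*} [AddCommGroup U] [Module k U] [AddCommGroup V] [Module k V]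
  [AddCommGroup W] [Module k W] [AddCommGroup X] [Module k X] [AddCommGroup Y] [Module k Y]
  {υ : Representation k G U} {ρ : Representation k G V} {σ : Representation k G W}
  {τ : Representation k G X} {π : Representation k G Y}

/-- A linear map commuting with the group actions, as an intertwining map. -/
abbrev toIntertwining (f : V →ₗ[k] W) (h : ∀ g v, f (ρ g v) = σ g (f v)) :
    ρ.IntertwiningMap σ :=
  f.intertwiningMap_of_isIntertwiningMap ρ σ h

@[simp]
theorem toIntertwining_apply (f : V →ₗ[k] W) (h : ∀ g v, f (ρ g v) = σ g (f v)) (v : V) :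
    toIntertwining (ρ := ρ) (σ := σ) f h v = f v := rfl

theorem IsSummand.refl : IsSummand ρ ρ := ⟨.id ρ, .id ρ, fun _ => rfl⟩

theorem IsSummand.trans (h₁ : IsSummand υ ρ) (h₂ : IsSummand ρ σ) : IsSummand υ σ := by
  obtain ⟨i, r, h⟩ := h₁
  obtain ⟨j, s, h'⟩ := h₂
  exact ⟨j.comp i, r.comp s, fun x => by simp [h, h']⟩

theorem IsSummand.of_equiv (e : ρ.Equiv σ) : IsSummand ρ σ :=
  ⟨e.toIntertwiningMap, e.symm.toIntertwiningMap, fun x => by simp⟩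

theorem IsSummand.of_equiv' (e : ρ.Equiv σ) : IsSummand σ ρ := .of_equiv e.symm

theorem IsSummand.inl : IsSummand ρ (ρ.prod σ) :=
  ⟨IntertwiningMap.inl k ρ σ, IntertwiningMap.fst k ρ σ,
    fun _ => rfl⟩

theorem IsSummand.inr : IsSummand σ (ρ.prod σ) :=
  ⟨IntertwiningMap.inr k ρ σ, IntertwiningMap.snd k ρ σ,
    fun _ => rfl⟩

theorem IsSummand.finite [Module.Finite k V] (h : IsSummand σ ρ) : Module.Finite k W := by
  obtain ⟨i, r, h⟩ := h
  exact Module.Finite.of_surjective r.toLinearMap fun x => ⟨i x, h x⟩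

/-- An equivariant linear equivalence. -/
abbrev toEquiv (e : V ≃ₗ[k] W) (h : ∀ g v, e (ρ g v) = σ g (e v)) : ρ.Equiv σ :=
  .mk e fun g => LinearMap.ext (h g)

theorem IsSummand.tprod (h₁ : IsSummand ρ σ) (h₂ : IsSummand τ π) :
    IsSummand (ρ.tprod τ) (σ.tprod π) := by
  obtain ⟨i, r, h⟩ := h₁
  obtain ⟨j, s, h'⟩ := h₂
  refine ⟨i.tensor j, r.tensor s, fun x => ?_⟩
  have : (r.toLinearMap ∘ₗ i.toLinearMap) = LinearMap.id := LinearMap.ext h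
  have h2 : (s.toLinearMap ∘ₗ j.toLinearMap) = LinearMap.id := LinearMap.ext h'
  change TensorProduct.map r.toLinearMap s.toLinearMap
    (TensorProduct.map i.toLinearMap j.toLinearMap x) = x
  rw [← LinearMap.comp_apply, ← TensorProduct.map_comp, this, h2, TensorProduct.map_id]
  rfl

/-- Pre- and postcomposition with intertwining maps. -/
def linHomMap (a : υ.IntertwiningMap ρ) (b : σ.IntertwiningMap τ) :
    (linHom ρ σ).IntertwiningMap (linHom υ τ) :=
  toIntertwining (b.toLinearMap.compRight k ∘ₗ LinearMap.lcomp k W a.toLinearMap) fun g f => by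
    ext x
    simp [LinearMap.lcomp, a.isIntertwining, b.isIntertwining, IntertwiningMap.toLinearMap_apply]

@[simp]
theorem linHomMap_apply (a : υ.IntertwiningMap ρ) (b : σ.IntertwiningMap τ) (f : V →ₗ[k] W) :
    linHomMap a b f = b.toLinearMap ∘ₗ f ∘ₗ a.toLinearMap := rfl

theorem IsSummand.linHom (h₁ : IsSummand υ ρ) (h₂ : IsSummand σ τ) :
    IsSummand (linHom υ σ) (linHom ρ τ) := by
  obtain ⟨i, r, h⟩ := h₁
  obtain ⟨j, s, h'⟩ := h₂
  refine ⟨linHomMap r j, linHomMap i s, fun x => ?_⟩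
  ext v
  simp [h, h']

/-- `Hom(M ⊗ N, M' ⊗ N') ≅ Hom(M, M') ⊗ Hom(N, N')` equivariantly. -/
def linHomTensorEquiv [Module.Finite k V] [Module.Finite k W]
    [Module.Finite k X] [Module.Finite k Y] :
    ((linHom ρ τ).tprod (linHom σ π)).Equiv (linHom (ρ.tprod σ) (τ.tprod π)) :=
  toEquiv (homTensorHomEquiv k V W X Y) fun g x => by
    induction x with
    | zero => simp
    | add x y hx hy => simp only [map_add, hx, hy]
    | tmul a b =>
      ext v w
      simp [homTensorHomEquiv_apply]

/-- The commutativity isomorphism of tensor products of representations. -/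
def tprodComm : (ρ.tprod σ).Equiv (σ.tprod ρ) :=
  toEquiv (TensorProduct.comm k V W) fun g x => by
    induction x with
    | zero => simp
    | add x y hx hy => simp only [map_add, hx, hy]
    | tmul a b => simp

/-- The associativity isomorphism of tensor products of representations. -/
def tprodAssoc : ((ρ.tprod σ).tprod τ).Equiv (ρ.tprod (σ.tprod τ)) :=
  toEquiv (TensorProduct.assoc k V W X) fun g x => by
    have : (TensorProduct.assoc k V W X).toLinearMap ∘ₗ ((ρ.tprod σ).tprod τ) g =
        (ρ.tprod (σ.tprod τ)) g ∘ₗ (TensorProduct.assoc k V W X).toLinearMap := by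
      ext; simp
    exact congr($this x)

/-- The unit isomorphism of tensor products of representations. -/
def trivialTprod {L : Type*} [AddCommGroup L] [Module k L] (e : L ≃ₗ[k] k) :
    ((trivial k G L).tprod ρ).Equiv ρ :=
  toEquiv ((TensorProduct.congr e (.refl k V)).trans (TensorProduct.lid k V)) fun g x => by
    induction x with
    | zero => simp
    | add x y hx hy => simp only [map_add, hx, hy]
    | tmul a b => simp

/-- The evaluation isomorphism `Hom(k, M) ≅ M`. -/
def linHomTrivial {L : Type*} [AddCommGroup L] [Module k L] (e : L ≃ₗ[k] k) :
    (linHom (trivial k G L) ρ).Equiv ρ :=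
  toEquiv ((e.arrowCongr (.refl k V)).trans (LinearMap.ringLmapEquivSelf k k V)) fun g x => by
    simp [LinearEquiv.arrowCongr_apply]

/-- An equivariant isomorphism induces one of Hom-modules. -/
theorem IsSummand.linHom_of_equiv (e₁ : υ.Equiv ρ) (e₂ : σ.Equiv τ) :
    IsSummand (Representation.linHom υ σ) (Representation.linHom ρ τ) :=
  .linHom (.of_equiv e₁) (.of_equiv e₂)

end Summands

/-! ### The family of non-Sylow `p`-subgroups -/

section NonSylow

variable {p : ℕ} {G : Type*} [Group G]

/-- `H` is a non-Sylow `p`-subgroup of `G`. -/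
def IsNonSylow (p : ℕ) (H : Subgroup G) : Prop :=
  IsPGroup p H ∧ ∀ P : Sylow p G, (P : Subgroup G) ≠ H

theorem IsNonSylow.mono {H K : Subgroup G} (hK : IsNonSylow p K) (h : H ≤ K) :
    IsNonSylow p H :=
  ⟨hK.1.to_le h, fun P hP => hK.2 P (P.3 hK.1 (hP.trans_le h)).symm⟩

theorem IsNonSylow.dvd_index [Fact p.Prime] [Finite G] {H : Subgroup G} (hH : IsNonSylow p H) :
    p ∣ H.index := by
  by_contra h
  exact hH.2 (hH.1.toSylow h) (IsPGroup.toSylow_coe _ _)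

theorem isNonSylow_of_lt {P : Sylow p G} {Q : Subgroup G} (h : Q < P) : IsNonSylow p Q :=
  ⟨P.2.to_le h.le, fun R hR => by
    have := R.3 P.2 (hR.trans_le h.le)
    exact h.ne (hR.symm.trans this.symm)⟩

/-- A representative of a conjugacy class of non-Sylow `p`-subgroups. -/
def repSubgroup (c : Quotient (nonSylowConj p G)) : Subgroup G := (Quotient.out c).1

theorem isNonSylow_repSubgroup (c : Quotient (nonSylowConj p G)) :
    IsNonSylow p (repSubgroup c) := (Quotient.out c).2

/-- The disjoint union of the `G`-sets `G/Q`, `Q` running over representatives of the conjugacy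
classes of non-Sylow `p`-subgroups. -/
abbrev NonSylowSet (p : ℕ) (G : Type*) [Group G] : Type _ :=
  Σ c : Quotient (nonSylowConj p G), G ⧸ repSubgroup c

instance [Finite G] : Finite (NonSylow p G) := by
  unfold NonSylow; infer_instance

instance [Finite G] : Fintype (Quotient (nonSylowConj p G)) := Fintype.ofFinite _

instance [Finite G] (c : Quotient (nonSylowConj p G)) : Fintype (G ⧸ repSubgroup c) :=
  Fintype.ofFinite _

theorem stabilizer_quotient_mk {H : Subgroup G} (g : G) :
    MulAction.stabilizer G (g : G ⧸ H) = H.map (MulAut.conj g).toMonoidHom := by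
  have := MulAction.stabilizer_smul_eq_stabilizer_map_conj g ((1 : G) : G ⧸ H)
  rw [MulAction.stabilizer_quotient] at this
  rw [← this]; simp

theorem IsNonSylow.conj {H : Subgroup G} (hH : IsNonSylow p H) (g : G) :
    IsNonSylow p (H.map (MulAut.conj g).toMonoidHom) := by
  refine ⟨hH.1.map _, fun P hP => hH.2 (g⁻¹ • P) ?_⟩
  rw [Sylow.coe_subgroup_smul, hP]
  ext x
  simp [Subgroup.mem_map, Subgroup.mem_pointwise_smul_iff_inv_smul_mem]

theorem NonSylowSet.stabilizer (x : NonSylowSet p G) :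
    IsNonSylow p (MulAction.stabilizer G x) := by
  obtain ⟨c, q⟩ := x
  induction q using QuotientGroup.induction_on with | _ g
  have : MulAction.stabilizer G (⟨c, g⟩ : NonSylowSet p G) ≤
      MulAction.stabilizer G (g : G ⧸ repSubgroup c) := fun h hh => by
    simpa [MulAction.mem_stabilizer_iff] using hh
  refine IsNonSylow.mono ?_ this
  rw [stabilizer_quotient_mk]
  exact IsNonSylow.conj (isNonSylow_repSubgroup c) g

end NonSylow

/-! ### Sums of relative traces -/

section RelTrace

variable {k : Type*} [Field k] {G : Type*} [Group G]
  {V W X : Type*} [AddCommGroup V] [Module k V]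
  [AddCommGroup W] [Module k W] [AddCommGroup X] [Module k X]
  {ρ : Representation k G V} {σ : Representation k G W} {τ : Representation k G X}

/-- An equivariant function from a `G`-set to a representation. -/
def IsEquivariant {Z : Type*} [MulAction G Z] (ρ : Representation k G V) (f : Z → V) : Prop :=
  ∀ (g : G) (z : Z), f (g • z) = ρ g (f z)

theorem IsEquivariant.comp {Z : Type*} [MulAction G Z] {f : Z → V} (hf : IsEquivariant ρ f)
    (φ : ρ.IntertwiningMap σ) : IsEquivariant σ (φ ∘ f) := fun g z => by
  simp [hf g z, φ.isIntertwining]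

variable [Finite G] (p : ℕ)

/-- The space of sums of relative traces from non-Sylow `p`-subgroups. -/
def relTrace (ρ : Representation k G V) : Submodule k V where
  carrier := {v | ∃ f : NonSylowSet p G → V, IsEquivariant ρ f ∧ ∑ x, f x = v}
  add_mem' := by
    rintro _ _ ⟨f, hf, rfl⟩ ⟨f', hf', rfl⟩
    exact ⟨f + f', fun g z => by simp [hf g z, hf' g z], by simp [Finset.sum_add_distrib]⟩
  zero_mem' := ⟨0, fun g z => by simp, by simp⟩
  smul_mem' := by
    rintro a _ ⟨f, hf, rfl⟩
    exact ⟨a • f, fun g z => by simp [hf g z], by simp [Finset.smul_sum]⟩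

variable {p}

theorem map_mem_relTrace (φ : ρ.IntertwiningMap σ) {v : V} (hv : v ∈ relTrace p ρ) :
    φ v ∈ relTrace p σ := by
  obtain ⟨f, hf, rfl⟩ := hv
  exact ⟨φ ∘ f, hf.comp φ, by simp⟩

/-- An equivariant function into a trivial module is constant on each `G/Q`, so its sum there is a
multiple of the index of `Q`, which is divisible by `p`. -/
theorem relTrace_trivial [Fact p.Prime] [CharP k p] {v : V}
    (hv : v ∈ relTrace p (trivial k G V)) : v = 0 := by
  obtain ⟨f, hf, rfl⟩ := hv
  rw [Fintype.sum_sigma]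
  refine Finset.sum_eq_zero fun c _ => ?_
  have : ∀ q : G ⧸ repSubgroup c, f ⟨c, q⟩ = f ⟨c, ((1 : G) : G ⧸ repSubgroup c)⟩ := by
    intro q
    induction q using QuotientGroup.induction_on with | _ g
    have := hf g ⟨c, ((1 : G) : G ⧸ repSubgroup c)⟩
    simpa using this
  rw [Finset.sum_congr rfl fun q _ => this q, Finset.sum_const, Finset.card_univ,
    ← Nat.card_eq_fintype_card, ← Subgroup.index, ← Nat.cast_smul_eq_nsmul k,
    (CharP.cast_eq_zero_iff k p _).2 (isNonSylow_repSubgroup c).dvd_index, zero_smul]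

/-- Extension by zero to the other classes. Stating `hH` as an equation lets `H` be a stabilizer
that is only propositionally a chosen representative. -/
theorem sum_quotient_mem_relTrace (c : Quotient (nonSylowConj p G)) (H : Subgroup G)
    [Fintype (G ⧸ H)] (hH : H = repSubgroup c) (f : G ⧸ H → V) (hf : IsEquivariant ρ f) :
    ∑ q, f q ∈ relTrace p ρ := by
  classical
  subst hH
  let F (d : Quotient (nonSylowConj p G)) (q : G ⧸ repSubgroup d) : V :=
    if h : d = c then f (h ▸ q) else 0
  refine ⟨fun x => F x.1 x.2, ?_, ?_⟩
  · rintro g ⟨d, q⟩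
    by_cases h : d = c
    · subst h
      simpa [F] using hf g q
    · simp [F, h]
  · rw [Fintype.sum_sigma, Finset.sum_eq_single c]
    · refine Finset.sum_congr (by ext; simp) fun q _ => ?_
      simp [F]
    · intro d _ h
      simp [F, h]
    · simp

omit [Finite G] in
theorem exists_smul_stabilizer {Z : Type*} [MulAction G Z] (z : Z)
    (h : IsNonSylow p (MulAction.stabilizer G z)) :
    ∃ (g : G) (c : Quotient (nonSylowConj p G)),
      MulAction.stabilizer G (g • z) = repSubgroup c := by
  let Q : NonSylow p G := ⟨_, h⟩
  obtain ⟨g, hg⟩ : (nonSylowConj p G).r Q (Quotient.out ⟦Q⟧) :=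
    (nonSylowConj p G).symm (Quotient.mk_out Q)
  exact ⟨g, ⟦Q⟧, by rw [MulAction.stabilizer_smul_eq_stabilizer_map_conj]; exact hg⟩

/-- Relative traces do not depend on the chosen representatives: each orbit of `Z` has a point whose
stabilizer is a representative, so `Z` decomposes into the corresponding coset spaces. -/
theorem sum_mem_relTrace {Z : Type*} [MulAction G Z] [Fintype Z]
    (hZ : ∀ z : Z, IsNonSylow p (MulAction.stabilizer G z)) {f : Z → V}
    (hf : IsEquivariant ρ f) : ∑ z, f z ∈ relTrace p ρ := by
  classical
  have key (ω : MulAction.orbitRel.Quotient G Z) : ∃ (z : Z) (c : Quotient (nonSylowConj p G)),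
      Quotient.mk'' z = ω ∧ MulAction.stabilizer G z = repSubgroup c := by
    obtain ⟨g, c, h⟩ := exists_smul_stabilizer ω.out (hZ _)
    refine ⟨g • ω.out, c, ?_, h⟩
    conv_rhs => rw [← Quotient.out_eq' ω]
    exact Quotient.sound' (MulAction.mem_orbit _ _)
  choose φ c hφ hc using key
  have : Fintype (MulAction.orbitRel.Quotient G Z) := Fintype.ofFinite _
  have inst : ∀ ω, Fintype (G ⧸ MulAction.stabilizer G (φ ω)) := fun _ => Fintype.ofFinite _
  let e : Z ≃ Σ ω, G ⧸ MulAction.stabilizer G (φ ω) := MulAction.selfEquivSigmaOrbitsQuotientStabilizer' G Z hφ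
  rw [← e.symm.sum_comp, Fintype.sum_sigma]
  refine Submodule.sum_mem _ fun ω _ => ?_
  refine sum_quotient_mem_relTrace (c ω) _ (hc ω) (fun q => f (e.symm ⟨ω, q⟩)) fun g q => ?_
  have he (q) : e.symm ⟨ω, q⟩ = MulAction.ofQuotientStabilizer G (φ ω) q := by
    rfl
  simp only [he]
  rw [MulAction.ofQuotientStabilizer_smul, hf]

end RelTrace

/-! ### Trace-projective modules -/

section TraceProjective

variable {k : Type*} [Field k] {G : Type*} [Group G]
  {V W X : Type*} [AddCommGroup V] [Module k V]
  [AddCommGroup W] [Module k W] [AddCommGroup X] [Module k X]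
  {ρ : Representation k G V} {σ : Representation k G W} {τ : Representation k G X}

/-- The trace as an intertwining map to the trivial representation. -/
def traceMap (ρ : Representation k G V) :
    (linHom ρ ρ).IntertwiningMap (trivial k G k) :=
  toIntertwining (LinearMap.trace k V) fun g f => by
    rw [linHom_apply, ← Module.End.mul_eq_comp, ← Module.End.mul_eq_comp,
      LinearMap.trace_mul_comm, mul_assoc, ← map_mul]
    simp

@[simp]
theorem traceMap_apply (f : V →ₗ[k] V) : traceMap ρ f = LinearMap.trace k V f := rfl

variable [Finite G] {p : ℕ}

variable (p) in
/-- The identity is a sum of relative traces from non-Sylow `p`-subgroups. -/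
def IsTraceProjective (ρ : Representation k G V) : Prop :=
  LinearMap.id ∈ relTrace p (linHom ρ ρ)

theorem IsTraceProjective.of_isSummand (hρ : IsTraceProjective p ρ) (h : IsSummand σ ρ) :
    IsTraceProjective p σ := by
  obtain ⟨i, r, h⟩ := h
  have := map_mem_relTrace (linHomMap i r) hρ
  have e : linHomMap i r LinearMap.id = LinearMap.id := by
    ext x; simp [h]
  rwa [e] at this

theorem IsTraceProjective.tprod_left (hρ : IsTraceProjective p ρ) :
    IsTraceProjective p (ρ.tprod σ) := by
  let φ : (linHom ρ ρ).IntertwiningMap (linHom (ρ.tprod σ) (ρ.tprod σ)) :=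
    toIntertwining (LinearMap.rTensorHom W) fun g f => by
      ext v w
      simp
  have := map_mem_relTrace φ hρ
  rwa [show φ LinearMap.id = LinearMap.id from LinearMap.rTensor_id _ _] at this

theorem not_isTraceProjective_trivial [Fact p.Prime] [CharP k p] :
    ¬ IsTraceProjective p (trivial k G k) := fun h => by
  let φ : (linHom (trivial k G k) (trivial k G k)).IntertwiningMap (trivial k G k) :=
    toIntertwining (LinearMap.applyₗ 1) fun g f => by simp
  have := relTrace_trivial (map_mem_relTrace φ h)
  simp [φ] at this

theorem trace_eq_zero_of_mem_relTrace [Fact p.Prime] [CharP k p] {f : V →ₗ[k] V}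
    (hf : f ∈ relTrace p (linHom ρ ρ)) : LinearMap.trace k V f = 0 :=
  relTrace_trivial (map_mem_relTrace (traceMap ρ) hf)

/-- A representation is trace-projective if the ideal of relative traces contains a left inverse
of some endomorphism. -/
theorem isTraceProjective_of_comp_eq_id {f : V →ₗ[k] V} (hf : f ∈ relTrace p (linHom ρ ρ))
    (a : ρ.IntertwiningMap ρ) (h : f ∘ₗ a.toLinearMap = LinearMap.id) :
    IsTraceProjective p ρ := by
  have := map_mem_relTrace (linHomMap a (.id ρ)) hf
  rwa [show linHomMap a (.id ρ) f = LinearMap.id from h] at this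

theorem IsTraceProjective.prod (hρ : IsTraceProjective p ρ) (hσ : IsTraceProjective p σ) :
    IsTraceProjective p (ρ.prod σ) := by
  have h₁ := map_mem_relTrace
    (linHomMap (IntertwiningMap.fst k ρ σ) (IntertwiningMap.inl k ρ σ)) hρ
  have h₂ := map_mem_relTrace
    (linHomMap (IntertwiningMap.snd k ρ σ) (IntertwiningMap.inr k ρ σ)) hσ
  have := (relTrace p (linHom (ρ.prod σ) (ρ.prod σ))).add_mem h₁ h₂
  refine Eq.mp (congrArg (· ∈ relTrace p (linHom (ρ.prod σ) (ρ.prod σ))) ?_) this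
  refine LinearMap.ext fun x => ?_
  exact congr($(IntertwiningMap.coprod_inl_inr (ρ := ρ) (σ := σ)) x)

/-- The module `M` is a summand of `End(M) ⊗ M`: evaluation splits `v ↦ id ⊗ v`. -/
theorem IsTraceProjective.of_linHom_self (h : IsTraceProjective p (linHom ρ ρ)) :
    IsTraceProjective p ρ := by
  refine (h.tprod_left (σ := ρ)).of_isSummand ⟨toIntertwining
    (TensorProduct.mk k _ _ LinearMap.id) fun g v => ?_, toIntertwining
    (TensorProduct.lift LinearMap.id) fun g v => ?_, fun v => by simp⟩
  · have : ρ g ∘ₗ ρ g⁻¹ = LinearMap.id := by ext; simp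
    simp [this]
  · induction v with
    | zero => simp
    | add x y hx hy => simp only [map_add, hx, hy]
    | tmul a b => simp

end TraceProjective

/-! ### Higman's criterion -/

section Higman

variable {k : Type*} [Field k] {G : Type*} [Group G]
  {V : Type*} [AddCommGroup V] [Module k V] {ρ : Representation k G V}

omit [Group G] in
theorem constr_single {A : Type*} [AddCommGroup A] [Module k A] (f : G → A) (g : G) :
    (MonoidAlgebra.basis G k).constr k f (MonoidAlgebra.single g 1) = f g := by
  simpa using (MonoidAlgebra.basis G k).constr_basis k f g

/-- The part of an induced representation supported on a coset. -/
def cosetProj (H : Subgroup G) (ρ : Representation k G V) (q : G ⧸ H) :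
    IndV H.subtype (ρ.comp H.subtype) →ₗ[k] IndV H.subtype (ρ.comp H.subtype) := by
  classical
  -- The coinvariants identify `g ⊗ v` with `hg ⊗ hv`, so the left coset is that of `g⁻¹`.
  let π : MonoidAlgebra k G →ₗ[k] MonoidAlgebra k G :=
    (MonoidAlgebra.basis G k).constr k fun g =>
      if ((g⁻¹ : G) : G ⧸ H) = q then MonoidAlgebra.single g 1 else 0
  exact Coinvariants.map _ _ (toIntertwining (π.rTensor V) fun h x => by
    have : π.rTensor V ∘ₗ Representation.tprod ((leftRegular k G).comp H.subtype)
        (ρ.comp H.subtype) h =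
      Representation.tprod ((leftRegular k G).comp H.subtype)
        (ρ.comp H.subtype) h ∘ₗ π.rTensor V := by
      ext g v
      have (g : G) : π (MonoidAlgebra.single g 1) =
          if ((g⁻¹ : G) : G ⧸ H) = q then MonoidAlgebra.single g 1 else 0 :=
        constr_single _ g
      have e : (((h * g : G)⁻¹ : G) : G ⧸ H) = ((g⁻¹ : G) : G ⧸ H) := by
        rw [mul_inv_rev]
        exact QuotientGroup.mk_mul_of_mem _ (H.inv_mem h.2)
      by_cases hq : ((g⁻¹ : G) : G ⧸ H) = q
      · simp [this, hq, e, -mul_inv_rev]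
      · simp [this, hq, e, -mul_inv_rev]
    exact congr($this x))

open Classical in
theorem cosetProj_mk (H : Subgroup G) (q : G ⧸ H) (g : G) (v : V) :
    cosetProj H ρ q (IndV.mk _ _ g v) =
      if ((g⁻¹ : G) : G ⧸ H) = q then IndV.mk _ _ g v else 0 := by
  have := constr_single (k := k) (fun g : G =>
    if ((g⁻¹ : G) : G ⧸ H) = q then MonoidAlgebra.single g (1 : k) else 0) g
  by_cases hq : ((g⁻¹ : G) : G ⧸ H) = q
  · simp [cosetProj, this, hq]
  · simp [cosetProj, this, hq]

theorem isEquivariant_cosetProj (H : Subgroup G) :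
    IsEquivariant (linHom (ind H.subtype (ρ.comp H.subtype)) (ind H.subtype (ρ.comp H.subtype)))
      (cosetProj H ρ) := by
  classical
  intro g q
  refine IndV.hom_ext _ _ fun h => LinearMap.ext fun v => ?_
  rw [linHom_apply]
  simp only [LinearMap.comp_apply]
  have h2 : ((((h * g⁻¹⁻¹ : G))⁻¹ : G) : G ⧸ H) = q ↔ ((h⁻¹ : G) : G ⧸ H) = g • q := by
    rw [← inv_smul_eq_iff]
    simp
  have e1 := ind_mk H.subtype (ρ.comp H.subtype) g⁻¹ h v
  have e2 := cosetProj_mk (ρ := ρ) H (g • q) h v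
  have e3 := cosetProj_mk (ρ := ρ) H q (h * g⁻¹⁻¹) v
  have e4 := ind_mk H.subtype (ρ.comp H.subtype) g (h * g⁻¹⁻¹) v
  simp only [LinearMap.comp_apply] at e1 e2 e3 e4
  rw [e1, e2, e3]
  by_cases hq : ((h⁻¹ : G) : G ⧸ H) = g • q
  · rw [if_pos hq, if_pos (h2.2 hq), e4]
    simp
  · rw [if_neg hq, if_neg (mt h2.1 hq), map_zero]

theorem sum_cosetProj (H : Subgroup G) [Fintype (G ⧸ H)] :
    ∑ q, cosetProj H ρ q = LinearMap.id := by
  classical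
  refine IndV.hom_ext _ _ fun h => LinearMap.ext fun v => ?_
  rw [LinearMap.comp_apply, LinearMap.sum_apply]
  simp only [cosetProj_mk, Finset.sum_ite_eq, Finset.mem_univ, if_true]
  rfl

/-- The inclusions of the conjugates of a representation into an induced representation. -/
def cosetIncl (H : Subgroup G) (ρ : Representation k G V) (q : G ⧸ H) :
    V →ₗ[k] IndV H.subtype (ρ.comp H.subtype) :=
  Quotient.liftOn' q (fun g => IndV.mk H.subtype (ρ.comp H.subtype) g⁻¹ ∘ₗ ρ g⁻¹) fun a b hab => by
    ext v
    rw [QuotientGroup.leftRel_apply] at hab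
    have := Coinvariants.mk_self_apply (Representation.tprod ((leftRegular k G).comp H.subtype)
        (ρ.comp H.subtype)) ⟨_, H.inv_mem hab⟩ (MonoidAlgebra.single a⁻¹ 1 ⊗ₜ ρ a⁻¹ v)
    simpa [← Module.End.mul_apply, ← map_mul] using this.symm

theorem cosetIncl_smul (H : Subgroup G) (g : G) (q : G ⧸ H) (v : V) :
    cosetIncl H ρ (g • q) (ρ g v) =
      ind H.subtype (ρ.comp H.subtype) g (cosetIncl H ρ q v) := by
  induction q using QuotientGroup.induction_on with | _ a
  change cosetIncl H ρ ((g * a : G) : G ⧸ H) (ρ g v) = _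
  change IndV.mk _ _ (g * a)⁻¹ (ρ (g * a)⁻¹ (ρ g v)) =
    ind H.subtype (ρ.comp H.subtype) g (IndV.mk _ _ a⁻¹ (ρ a⁻¹ v))
  rw [ind_mk]
  simp [← Module.End.mul_apply, ← map_mul]

/-- The counit of the adjunction between induction and restriction, as a linear map. -/
def indCounitLinear (H : Subgroup G) (ρ : Representation k G V) :
    IndV H.subtype (ρ.comp H.subtype) →ₗ[k] V :=
  Coinvariants.lift _ (TensorProduct.lift
      ((MonoidAlgebra.basis G k).constr k fun g => ρ g⁻¹)) fun h => by
    ext g v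
    simp [constr_single, ← Module.End.mul_apply, ← map_mul]

theorem indCounitLinear_mk (H : Subgroup G) (g : G) (v : V) :
    indCounitLinear H ρ (IndV.mk _ _ g v) = ρ g⁻¹ v := by
  simp [indCounitLinear, constr_single]

/-- The counit of the adjunction between induction and restriction. -/
def indCounit (H : Subgroup G) (ρ : Representation k G V) :
    (ind H.subtype (ρ.comp H.subtype)).IntertwiningMap ρ :=
  toIntertwining (indCounitLinear H ρ) fun g x => by
    have : indCounitLinear H ρ ∘ₗ ind H.subtype (ρ.comp H.subtype) g =
        ρ g ∘ₗ indCounitLinear H ρ := by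
      refine IndV.hom_ext _ _ fun h => LinearMap.ext fun v => ?_
      change indCounitLinear H ρ (ind H.subtype (ρ.comp H.subtype) g (IndV.mk _ _ h v)) =
        ρ g (indCounitLinear H ρ (IndV.mk _ _ h v))
      rw [ind_mk, indCounitLinear_mk, indCounitLinear_mk]
      simp
    exact LinearMap.congr_fun this x

theorem indCounit_cosetIncl (H : Subgroup G) (q : G ⧸ H) (v : V) :
    indCounit H ρ (cosetIncl H ρ q v) = v := by
  induction q using QuotientGroup.induction_on with | _ a
  change indCounitLinear H ρ (IndV.mk _ _ a⁻¹ (ρ a⁻¹ v)) = v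
  rw [indCounitLinear_mk]
  simp

/-- Higman's criterion. -/
theorem isRelProjective_iff [Finite G] (H : Subgroup G) [Fintype (G ⧸ H)] :
    IsRelProjective H ρ ↔ ∃ f : G ⧸ H → V →ₗ[k] V, IsEquivariant (linHom ρ ρ) f ∧
      ∑ q, f q = LinearMap.id := by
  constructor
  · rintro ⟨i, r, h⟩
    -- The coset projections decompose the identity of the induced module; compressing them along
    -- `i` and `r` decomposes that of `ρ`.
    refine ⟨linHomMap i r ∘ cosetProj H ρ, (isEquivariant_cosetProj H).comp _, ?_⟩
    simp only [Function.comp_apply]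
    rw [← map_sum, sum_cosetProj]
    ext x
    simp [h]
  · rintro ⟨f, hf, h⟩
    -- The counit is the identity on each conjugate copy of `V`, so it sends the proposed section
    -- back to `∑ q, f q v = v`.
    refine ⟨toIntertwining (∑ q, cosetIncl H ρ q ∘ₗ f q) fun g v => ?_, indCounit H ρ,
      fun v => ?_⟩
    · simp only [LinearMap.sum_apply, LinearMap.comp_apply, map_sum]
      rw [← Equiv.sum_comp (MulAction.toPerm g)]
      refine Finset.sum_congr rfl fun q _ => ?_
      rw [MulAction.toPerm_apply, hf g q, ← cosetIncl_smul]
      simp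
    · simp [indCounit_cosetIncl, ← LinearMap.sum_apply, h]

end Higman

/-! ### Summands of permutation modules, and goodness -/

section Frames

variable {k : Type*} [Field k] {G : Type*} [Group G]
  {V W : Type*} [AddCommGroup V] [Module k V] [AddCommGroup W] [Module k W]
  {ρ : Representation k G V} {σ : Representation k G W}

/-- An equivariant system of vectors and covectors indexed by a finite `G`-set that exhibits a
representation as a direct summand of the permutation representation. -/
structure Frame (Z : Type*) [MulAction G Z] [Fintype Z] (ρ : Representation k G V) where
  /-- the vectors -/
  vec : Z → V
  /-- the covectors -/
  covec : Z → V →ₗ[k] k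
  vec_smul : IsEquivariant ρ vec
  covec_smul : ∀ g z x, covec (g • z) (ρ g x) = covec z x
  sum_eq : ∀ x, ∑ z, covec z x • vec z = x

namespace Frame

variable {Z : Type*} [MulAction G Z] [Fintype Z] {Y : Type*} [MulAction G Y] [Fintype Y]

theorem covec_apply (F : Frame Z ρ) (g : G) (z : Z) (x : V) :
    F.covec z (ρ g x) = F.covec (g⁻¹ • z) x := by
  rw [← F.covec_smul g (g⁻¹ • z), smul_inv_smul]

theorem isSummand (F : Frame Z ρ) : IsSummand ρ (ofMulAction k G Z) := by
  classical
  refine ⟨toIntertwining (∑ z, (F.covec z).smulRight (MonoidAlgebra.single z 1)) fun g x => ?_,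
    toIntertwining ((MonoidAlgebra.basis Z k).constr k F.vec) fun g x => ?_, fun x => ?_⟩
  · simp only [LinearMap.sum_apply, LinearMap.smulRight_apply, map_sum, map_smul,
      ofMulAction_single]
    rw [← Equiv.sum_comp (MulAction.toPerm g)]
    simp [F.covec_smul]
  · refine LinearMap.congr_fun (f := (MonoidAlgebra.basis Z k).constr k F.vec ∘ₗ
      ofMulAction k G Z g) (g := ρ g ∘ₗ (MonoidAlgebra.basis Z k).constr k F.vec) ?_ x
    ext z
    simp [constr_single, F.vec_smul g z, -Module.Basis.constr_apply_fintype]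
  · simp only [toIntertwining_apply, LinearMap.sum_apply, LinearMap.smulRight_apply, map_sum,
      map_smul, constr_single, F.sum_eq]

/-- The frame of a permutation representation. -/
def ofMulAction : Frame Z (Representation.ofMulAction k G Z) where
  vec z := MonoidAlgebra.single z 1
  covec z := (MonoidAlgebra.basis Z k).coord z
  vec_smul g z := by simp
  covec_smul g z x := by
    change (Representation.ofMulAction k G Z g x).coeff _ = x.coeff z
    simp
  sum_eq x := by
    simpa using (MonoidAlgebra.basis Z k).sum_repr x

/-- The frame induced on a direct summand. -/
def ofSummand (F : Frame Z ρ) (i : σ.IntertwiningMap ρ) (r : ρ.IntertwiningMap σ)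
    (h : ∀ x, r (i x) = x) : Frame Z σ where
  vec := r ∘ F.vec
  covec z := F.covec z ∘ₗ i.toLinearMap
  vec_smul := F.vec_smul.comp r
  covec_smul g z x := by simp [i.isIntertwining, F.covec_smul]
  sum_eq x := by
    conv_rhs => rw [← h x, ← F.sum_eq (i x)]
    simp

/-- Transport of a frame along an isomorphism of `G`-sets. -/
def congr (F : Frame Z ρ) (e : Y ≃ Z) (he : ∀ (g : G) y, e (g • y) = g • e y) : Frame Y ρ where
  vec := F.vec ∘ e
  covec := F.covec ∘ e
  vec_smul g z := by simp [he, F.vec_smul g]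
  covec_smul g z x := by simp [he, F.covec_smul]
  sum_eq x := by
    simpa using (e.sum_comp fun z => F.covec z x • F.vec z).trans (F.sum_eq x)

/-- The frame of a direct sum. -/
def prod (F : Frame Z ρ) (F' : Frame Y σ) : Frame (Z ⊕ Y) (ρ.prod σ) where
  vec := Sum.elim (fun z => (F.vec z, 0)) fun y => (0, F'.vec y)
  covec := Sum.elim (fun z => F.covec z ∘ₗ LinearMap.fst k V W)
    fun y => F'.covec y ∘ₗ LinearMap.snd k V W
  vec_smul := by
    rintro g (z | y)
    · simp [F.vec_smul g z]
    · simp [F'.vec_smul g y]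
  covec_smul := by
    rintro g (z | y) x
    · simp [F.covec_smul]
    · simp [F'.covec_smul]
  sum_eq x := by
    ext <;> simp [Prod.fst_sum, Prod.snd_sum, F.sum_eq, F'.sum_eq]

/-- The frame of a tensor product. -/
def tprod (F : Frame Z ρ) (F' : Frame Y σ) : Frame (Z × Y) (ρ.tprod σ) where
  vec z := F.vec z.1 ⊗ₜ F'.vec z.2
  covec z := LinearMap.mul' k k ∘ₗ TensorProduct.map (F.covec z.1) (F'.covec z.2)
  vec_smul g z := by simp [F.vec_smul g z.1, F'.vec_smul g z.2]
  covec_smul g z x := by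
    induction x with
    | zero => simp
    | add x y hx hy => simp only [map_add, hx, hy]
    | tmul a b => simp [F.covec_smul, F'.covec_smul]
  sum_eq x := by
    induction x with
    | zero => simp
    | add x y hx hy => simp only [map_add, add_smul, Finset.sum_add_distrib, hx, hy]
    | tmul a b =>
      conv_rhs => rw [← F.sum_eq a, ← F'.sum_eq b]
      rw [TensorProduct.sum_tmul, Fintype.sum_prod_type]
      simp only [TensorProduct.tmul_sum, TensorProduct.smul_tmul_smul]
      simp

/-- The frame of a dual representation. -/
def dual (F : Frame Z ρ) : Frame Z (linHom ρ (trivial k G k)) where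
  vec := F.covec
  covec z := LinearMap.applyₗ (F.vec z)
  vec_smul g z := by
    ext x
    simp [F.covec_apply]
  covec_smul g z f := by
    simp [F.vec_smul g z]
  sum_eq f := by
    ext x
    conv_rhs => rw [← F.sum_eq x]
    simp [mul_comm]

theorem finite (F : Frame Z ρ) : Module.Finite k V :=
  .of_surjective (Fintype.linearCombination k F.vec) fun x =>
    ⟨fun z => F.covec z x, F.sum_eq x⟩

end Frame

/-- The action is carried over to `Fin`, since the permutation module must be indexed by a `G`-set
in `Type`. -/
theorem isPPermutation_of_frame {Z : Type*} [MulAction G Z] [Fintype Z] (F : Frame Z ρ) :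
    IsPPermutation ρ := by
  let e := (Fintype.equivFin Z).symm
  let _ : MulAction G (Fin (Fintype.card Z)) := e.mulAction G
  refine ⟨Fin (Fintype.card Z), inferInstance, inferInstance, (F.congr e fun g y => ?_).isSummand⟩
  simp [Equiv.smul_def]

theorem IsPPermutation.exists_frame (h : IsPPermutation ρ) :
    ∃ (Z : Type) (_ : MulAction G Z) (_ : Fintype Z), Nonempty (Frame Z ρ) := by
  obtain ⟨Z, _, _, i, r, h⟩ := h
  have := Fintype.ofFinite Z
  exact ⟨Z, _, this, ⟨Frame.ofMulAction.ofSummand i r h⟩⟩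

theorem IsPPermutation.of_isSummand (h : IsPPermutation ρ) (hs : IsSummand σ ρ) :
    IsPPermutation σ := by
  obtain ⟨Z, h₁, h₂, h⟩ := h
  exact ⟨Z, h₁, h₂, hs.trans h⟩

/-- Every point of the `G`-set is either fixed or has a non-Sylow `p`-subgroup as stabilizer. -/
def IsNice (p : ℕ) (G : Type*) [Group G] (Z : Type*) [MulAction G Z] : Prop :=
  ∀ z : Z, MulAction.stabilizer G z = ⊤ ∨ IsNonSylow p (MulAction.stabilizer G z)

theorem IsNice.sum {p : ℕ} {Z Y : Type*} [MulAction G Z] [MulAction G Y] (hZ : IsNice p G Z)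
    (hY : IsNice p G Y) : IsNice p G (Z ⊕ Y) := by
  rintro (z | y)
  · have : MulAction.stabilizer G (Sum.inl z : Z ⊕ Y) = MulAction.stabilizer G z := by
      ext; simp [MulAction.mem_stabilizer_iff]
    exact this ▸ hZ z
  · have : MulAction.stabilizer G (Sum.inr y : Z ⊕ Y) = MulAction.stabilizer G y := by
      ext; simp [MulAction.mem_stabilizer_iff]
    exact this ▸ hY y

theorem IsNice.prod {p : ℕ} {Z Y : Type*} [MulAction G Z] [MulAction G Y] (hZ : IsNice p G Z)
    (hY : IsNice p G Y) : IsNice p G (Z × Y) := by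
  rintro ⟨z, y⟩
  have h : MulAction.stabilizer G (z, y) =
      MulAction.stabilizer G z ⊓ MulAction.stabilizer G y := by
    ext; simp [MulAction.mem_stabilizer_iff]
  rw [h]
  rcases hZ z with hz | hz
  · rcases hY y with hy | hy
    · exact Or.inl (by simp [hz, hy])
    · exact Or.inr (hy.mono inf_le_right)
  · exact Or.inr (hz.mono inf_le_left)

variable (p : ℕ)

/-- Direct summands of permutation representations on nice `G`-sets. -/
def IsGood (ρ : Representation k G V) : Prop :=
  ∃ (Z : Type) (_ : MulAction G Z) (_ : Fintype Z), IsNice p G Z ∧ Nonempty (Frame Z ρ)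

variable {p}

theorem isGood_of_frame {Z : Type*} [MulAction G Z] [Fintype Z] (hZ : IsNice p G Z)
    (F : Frame Z ρ) : IsGood p ρ := by
  let e := (Fintype.equivFin Z).symm
  let _ : MulAction G (Fin (Fintype.card Z)) := e.mulAction G
  have he (g : G) (y) : e (g • y) = g • e y := by simp [Equiv.smul_def]
  refine ⟨Fin (Fintype.card Z), inferInstance, inferInstance, fun z => ?_, ⟨F.congr e he⟩⟩
  have : MulAction.stabilizer G z = MulAction.stabilizer G (e z) := by
    ext g
    rw [MulAction.mem_stabilizer_iff, MulAction.mem_stabilizer_iff, ← he, e.apply_eq_iff_eq]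
  rw [this]
  exact hZ (e z)

theorem IsGood.isPPermutation (h : IsGood p ρ) : IsPPermutation ρ := by
  obtain ⟨Z, _, _, _, ⟨F⟩⟩ := h
  exact isPPermutation_of_frame F

theorem IsGood.of_isSummand (h : IsGood p ρ) (hs : IsSummand σ ρ) : IsGood p σ := by
  obtain ⟨Z, _, _, hZ, ⟨F⟩⟩ := h
  obtain ⟨i, r, h⟩ := hs
  exact isGood_of_frame hZ (F.ofSummand i r h)

theorem IsGood.of_equiv (h : IsGood p ρ) (e : ρ.Equiv σ) : IsGood p σ :=
  h.of_isSummand (.of_equiv' e)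

theorem IsGood.prod (h : IsGood p ρ) (h' : IsGood p σ) : IsGood p (ρ.prod σ) := by
  obtain ⟨Z, _, _, hZ, ⟨F⟩⟩ := h
  obtain ⟨Y, _, _, hY, ⟨F'⟩⟩ := h'
  exact isGood_of_frame (hZ.sum hY) (F.prod F')

theorem IsGood.tprod (h : IsGood p ρ) (h' : IsGood p σ) : IsGood p (ρ.tprod σ) := by
  obtain ⟨Z, _, _, hZ, ⟨F⟩⟩ := h
  obtain ⟨Y, _, _, hY, ⟨F'⟩⟩ := h'
  exact isGood_of_frame (hZ.prod hY) (F.tprod F')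

theorem IsGood.dual (h : IsGood p ρ) : IsGood p (linHom ρ (trivial k G k)) := by
  obtain ⟨Z, _, _, hZ, ⟨F⟩⟩ := h
  exact isGood_of_frame hZ F.dual

theorem IsGood.finite (h : IsGood p ρ) : Module.Finite k V := by
  obtain ⟨Z, _, _, _, ⟨F⟩⟩ := h
  exact F.finite

theorem isGood_trivial [Module.Finite k V] : IsGood p (trivial k G V) := by
  let b := Module.finBasis k V
  let _ : MulAction G (Fin (Module.finrank k V)) := 
    { smul _ z := z, one_smul _ := rfl, mul_smul _ _ _ := rfl }
  have hs (g : G) (z : Fin (Module.finrank k V)) : g • z = z := rfl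
  refine isGood_of_frame (Z := Fin (Module.finrank k V)) (fun z => .inl ?_)
    ⟨b, b.coord, fun g z => ?_, fun g z x => ?_, b.sum_repr⟩
  · ext; simp [MulAction.mem_stabilizer_iff, hs]
  · simp [hs]
  · simp [hs]

variable [Finite G]

/-- Applying the maps `f x` with `∑ x, f x = id` to the vectors of a frame on `Z` gives a frame on
`NonSylowSet p G × Z`, where stabilizers are contained in non-Sylow `p`-subgroups. -/
theorem IsTraceProjective.isGood (h : IsTraceProjective p ρ) (hρ : IsPPermutation ρ) :
    IsGood p ρ := by
  obtain ⟨f, hf, hsum⟩ := h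
  obtain ⟨Z, _, _, ⟨F⟩⟩ := hρ.exists_frame
  refine isGood_of_frame (Z := NonSylowSet p G × Z) (fun ⟨x, z⟩ => .inr ?_)
    ⟨fun y => f y.1 (F.vec y.2), fun y => F.covec y.2, fun g y => ?_, fun g y => ?_, fun x => ?_⟩
  · refine (NonSylowSet.stabilizer x).mono fun g hg => ?_
    exact congrArg Prod.fst hg
  · simp [hf g y.1, F.vec_smul g y.2]
  · exact F.covec_smul g y.2
  · rw [Fintype.sum_prod_type]
    simp only [← map_smul, ← map_sum, F.sum_eq, ← LinearMap.sum_apply, hsum, LinearMap.id_apply]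

/-- A direct summand of a permutation representation on a nice `G`-set such that every invariant
vector is killed by every invariant linear form is trace-projective. -/
theorem IsGood.isTraceProjective (h : IsGood p ρ)
    (h0 : ∀ u : V, (∀ g, ρ g u = u) → ∀ φ : ρ.IntertwiningMap (trivial k G k), φ u = 0) :
    IsTraceProjective p ρ := by
  classical
  obtain ⟨Z, _, _, hZ, ⟨F⟩⟩ := h
  let E (z : Z) : V →ₗ[k] V := (F.covec z).smulRight (F.vec z)
  have hE : IsEquivariant (linHom ρ ρ) E := fun g z => by
    ext x
    simp [E, F.vec_smul g z, F.covec_apply]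
  have hsum : ∑ z, E z = LinearMap.id := LinearMap.ext fun x => by
    simp [E, F.sum_eq]
  let A : MulAction G {z : Z // ¬ MulAction.stabilizer G z = ⊤} :=
    { smul g z := ⟨g • z.1, fun h => z.2 (by
        rw [MulAction.stabilizer_smul_eq_stabilizer_map_conj] at h
        exact Subgroup.map_injective (MulAut.conj g).injective (by
          rw [h]; exact (Subgroup.map_top_of_surjective _ (MulAut.conj g).surjective).symm))⟩
      one_smul z := Subtype.ext (one_smul G z.1)
      mul_smul g h z := Subtype.ext (mul_smul g h z.1) }
  have hA (g : G) (z : {z : Z // ¬ MulAction.stabilizer G z = ⊤}) :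
    ((g • z : {z : Z // ¬ MulAction.stabilizer G z = ⊤}) : Z) = g • z.1 := rfl
  -- The identity splits as `x + y`: here `y` collects the points with non-Sylow stabilizer, hence
  -- lies in the trace ideal, and `x` below collects the fixed points.
  let y : V →ₗ[k] V := ∑ z : {z : Z // ¬ MulAction.stabilizer G z = ⊤}, E z.1
  have hy : y ∈ relTrace p (linHom ρ ρ) := by
    refine sum_mem_relTrace (fun z => ?_) fun g z => ?_
    · refine ((hZ z.1).resolve_left z.2).mono fun g hg => ?_
      exact congrArg Subtype.val hg
    · rw [hA, hE]
  let x : V →ₗ[k] V := ∑ z : {z : Z // MulAction.stabilizer G z = ⊤}, E z.1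
  have hfix (z : {z : Z // MulAction.stabilizer G z = ⊤}) (g : G) : g • z.1 = z.1 := by
    have : g ∈ MulAction.stabilizer G z.1 := by
      rw [z.2]; trivial
    exact this
  have hxg (g : G) (v : V) : x (ρ g v) = ρ g (x v) := by
    simp only [x, LinearMap.sum_apply, map_sum]
    refine Finset.sum_congr rfl fun z _ => ?_
    have := congr($(hE g z.1) (ρ g v))
    rw [hfix] at this
    simpa using this
  have hxy : x + y = LinearMap.id := by
    rw [← hsum]
    exact Fintype.sum_subtype_add_sum_subtype (fun z => MulAction.stabilizer G z = ⊤) E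
  -- Fixed points contribute invariant vectors and invariant forms, which pair to zero by `h0`.
  have hx2 : x ∘ₗ x = 0 := by
    ext v
    have key (z z' : {z : Z // MulAction.stabilizer G z = ⊤}) : E z (E z' v) = 0 := by
      have hφ := h0 (F.vec z'.1) (fun g => by rw [← F.vec_smul g, hfix])
        (toIntertwining (F.covec z.1) fun g v => by
          conv_lhs => rw [← hfix z g, F.covec_smul]
          simp)
      have hφ : F.covec z.1 (F.vec z'.1) = 0 := hφ
      simp [E, hφ]
    simp [x, key]
  -- Since `y = 1 - x` and `x² = 0`, the equivariant map `1 + x` inverts `y`.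
  refine isTraceProjective_of_comp_eq_id hy
    (.id ρ + toIntertwining x hxg) ?_
  have : y = LinearMap.id - x := eq_sub_of_add_eq' hxy
  rw [this]
  ext v
  have := congr($hx2 v)
  simp only [LinearMap.comp_apply, LinearMap.zero_apply] at this
  simp [this]

end Frames

/-! ### Projectivity relative to `V(ℱ_G)` -/

section RelativeToFamily

/-- The section is `v ↦ ∑ z, vec z ⊗ f z v`, the retraction `t ⊗ v ↦ ε t • v` with `ε` the sum of
all covectors. The normalization `hF` says that `ε` is `1` on every frame vector, as for the
augmentation of a permutation module. -/
theorem Frame.isSummand_tprod {k : Type*} [Field k] {G : Type*} [Group G] {T V : Type*}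
    [AddCommGroup T] [Module k T] [AddCommGroup V] [Module k V] {τ : Representation k G T}
    {ρ : Representation k G V} {Z : Type*} [MulAction G Z] [Fintype Z] (F : Frame Z τ)
    (hF : ∀ z, ∑ x, F.covec x (F.vec z) = 1) {f : Z → V →ₗ[k] V}
    (hf : IsEquivariant (linHom ρ ρ) f) (hsum : ∑ z, f z = LinearMap.id) :
    IsSummand ρ (τ.tprod ρ) := by
  let ε : T →ₗ[k] k := ∑ x, F.covec x
  have hε (x) : ε (F.vec x) = 1 := by
    rw [LinearMap.sum_apply, hF]
  refine ⟨toIntertwining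
    (∑ x, TensorProduct.mk k _ V (F.vec x) ∘ₗ f x) fun g v => ?_,
    toIntertwining (TensorProduct.lift (ε.smulRight LinearMap.id)) fun g v => ?_, fun v => ?_⟩
  · simp only [LinearMap.sum_apply, map_sum]
    rw [← Equiv.sum_comp (MulAction.toPerm g)]
    simp [F.vec_smul g _, hf g _]
  · induction v with
    | zero => simp
    | add x y hx hy => simp only [map_add, hx, hy]
    | tmul a b =>
      have : ε (τ g a) = ε a := by
        simp only [ε, LinearMap.sum_apply]
        rw [← Equiv.sum_comp (MulAction.toPerm g)]
        simp [F.covec_smul]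
      simp [this]
  · simp [hε, ← LinearMap.sum_apply, hsum]

section DirectSum

variable {k : Type*} [Field k] {G : Type*} [Group G] {ι : Type*} [Fintype ι] [DecidableEq ι]
  {Y : ι → Type*} [∀ c, MulAction G (Y c)] [∀ c, Fintype (Y c)]

/-- The standard frame of a direct sum of permutation representations. -/
def Frame.directSum : Frame (Σ c, Y c)
    (Representation.directSum fun c => Representation.ofMulAction k G (Y c)) where
  vec x := DirectSum.lof k ι (fun c => MonoidAlgebra k (Y c)) x.1 (MonoidAlgebra.single x.2 1)
  covec x := (MonoidAlgebra.basis (Y x.1) k).coord x.2 ∘ₗ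
    DirectSum.component k ι (fun c => MonoidAlgebra k (Y c)) x.1
  vec_smul g x := by
    rw [Representation.directSum_apply, DirectSum.lmap_lof, ofMulAction_single]
    rfl
  covec_smul g x v := by
    change (DirectSum.lmap (fun _ => Representation.ofMulAction k G _ g) v x.1).coeff (g • x.2) =
      (v x.1).coeff x.2
    rw [DirectSum.lmap_apply, coeff_ofMulAction, inv_smul_smul]
  sum_eq v := by
    rw [Fintype.sum_sigma]
    induction v using DirectSum.induction_on with
    | zero => simp
    | add x y hx hy => simp only [map_add, add_smul, Finset.sum_add_distrib, hx, hy]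
    | of c m =>
      rw [Finset.sum_eq_single c]
      · change ∑ y, (MonoidAlgebra.basis (Y c) k).coord y (DirectSum.component k ι _ c
          (DirectSum.lof k ι (fun c => MonoidAlgebra k (Y c)) c m)) • _ =
          DirectSum.lof k ι (fun c => MonoidAlgebra k (Y c)) c m
        rw [DirectSum.component.lof_self]
        conv_rhs => rw [← (MonoidAlgebra.basis (Y c) k).sum_repr m]
        simp only [map_sum, map_smul, MonoidAlgebra.basis_apply, Module.Basis.coord_apply]
      · intro d _ hd
        refine Finset.sum_eq_zero fun y _ => ?_
        have : DirectSum.component k ι (fun c => MonoidAlgebra k (Y c)) d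
          (DirectSum.of (fun c => MonoidAlgebra k (Y c)) c m) = 0 :=
          DirectSum.of_eq_of_ne _ _ _ hd
        simp [this]
      · simp

theorem Frame.sum_covec_directSum (y : Σ c, Y c) :
    ∑ x, (Frame.directSum (k := k) (G := G)).covec x
      ((Frame.directSum (k := k) (G := G)).vec y) = 1 := by
  rw [Finset.sum_eq_single y]
  · simp only [Frame.directSum, LinearMap.comp_apply, DirectSum.component.lof_self]
    simp [← MonoidAlgebra.basis_apply]
  · rintro ⟨c, x⟩ - hx
    obtain ⟨d, y⟩ := y
    simp only [Frame.directSum, LinearMap.comp_apply]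
    by_cases h : c = d
    · subst h
      rw [DirectSum.component.lof_self, ← MonoidAlgebra.basis_apply, Module.Basis.coord_apply,
        Module.Basis.repr_self, Finsupp.single_eq_of_ne]
      rintro rfl
      exact hx rfl
    · have : DirectSum.component k ι (fun c => MonoidAlgebra k (Y c)) c
          (DirectSum.of (fun c => MonoidAlgebra k (Y c)) d (MonoidAlgebra.single y 1)) = 0 :=
          DirectSum.of_eq_of_ne _ _ _ h
      erw [this, map_zero]
  · simp

end DirectSum

variable {p : ℕ} {k : Type u} [Field k] {G : Type v} [Group G]

variable [Finite G]

open Classical in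
/-- The standard frame of `V(ℱ_G)`. -/
def vfFrame (p : ℕ) (k : Type u) [Field k] : Frame (NonSylowSet p G) (VF p k G) :=
  (Frame.directSum : Frame (NonSylowSet p G)
    (Representation.directSum fun c => ofMulAction k G (G ⧸ repSubgroup c)))

variable {V : Type u} [AddCommGroup V] [Module k V] {ρ : Representation k G V}

theorem isTraceProjective_VF : IsTraceProjective p (VF p k G) := by
  let F := vfFrame (G := G) p k
  refine ⟨fun x => (F.covec x).smulRight (F.vec x), fun g x => ?_, LinearMap.ext fun v => ?_⟩
  · ext v
    simp [F.vec_smul g x, F.covec_apply]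
  · simp [F.sum_eq]

/-- The rank-one coordinate projections show that `V(ℱ_G)` is itself trace-projective, a property
inherited by tensor products and summands. Conversely `N = ρ` works. -/
theorem isProjectiveRelTo_VF_iff [Module.Finite k V] :
    IsProjectiveRelTo (VF p k G) ρ ↔ IsTraceProjective p ρ := by
  constructor
  · rintro ⟨N, -, h⟩
    exact (isTraceProjective_VF.tprod_left).of_isSummand h
  · rintro ⟨f, hf, hsum⟩
    classical
    exact ⟨Rep.of ρ, ‹_›, (vfFrame (G := G) p k).isSummand_tprod
      (Frame.sum_covec_directSum (k := k) (G := G)) hf hsum⟩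

end RelativeToFamily

/-! ### Fitting's lemma for indecomposable modules -/

section Indecomposable

variable {k : Type*} [Field k] {G : Type*} [Group G]
  {V W : Type*} [AddCommGroup V] [Module k V] [AddCommGroup W] [Module k W]
  {ρ : Representation k G V} {σ : Representation k G W}

/-- For large `n` the kernel and range of `f ^ n` are complementary subrepresentations, so one of
them vanishes. -/
theorem IsIndecomposable.isNilpotent_or_isUnit [Module.Finite k V] (h : IsIndecomposable ρ)
    (f : ρ.IntertwiningMap ρ) :
    IsNilpotent (f.toLinearMap : Module.End k V) ∨ Function.Bijective f := by
  -- The condition `n ≥ 1` ensures that the kernel of `f` lies in that of `f ^ n`.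
  obtain ⟨n, hn, hn1⟩ := ((LinearMap.eventually_isCompl_ker_pow_range_pow
    (f.toLinearMap : Module.End k V)).and (Filter.eventually_ge_atTop 1)).exists
  have hc (g : G) (n : ℕ) (v : V) :
      (f.toLinearMap ^ n : Module.End k V) (ρ g v) = ρ g ((f.toLinearMap ^ n : Module.End k V) v) := by
    induction n generalizing v with
    | zero => simp
    | succ n ih => simp [pow_succ, f.isIntertwining, ih]
  let A : Subrepresentation ρ := ⟨LinearMap.ker (f.toLinearMap ^ n : Module.End k V),
    fun g v hv => by
      rw [LinearMap.mem_ker] at hv ⊢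
      rw [hc, hv, map_zero]⟩
  let B : Subrepresentation ρ := ⟨LinearMap.range (f.toLinearMap ^ n : Module.End k V), by
    rintro g _ ⟨v, rfl⟩
    exact ⟨ρ g v, hc g n v⟩⟩
  have hAB : IsCompl A B := by
    constructor
    · rw [disjoint_iff]
      exact Subrepresentation.toSubmodule_injective hn.inf_eq_bot
    · rw [codisjoint_iff]
      exact Subrepresentation.toSubmodule_injective hn.sup_eq_top
  rcases h.2 A B hAB with hA | hB
  · right
    have hA : LinearMap.ker (f.toLinearMap ^ n : Module.End k V) = ⊥ :=
      congrArg Subrepresentation.toSubmodule hA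
    have hinj : Function.Injective f.toLinearMap := by
      rw [← LinearMap.ker_eq_bot, eq_bot_iff, ← hA]
      intro v hv
      obtain ⟨m, rfl⟩ : ∃ m, n = m + 1 := ⟨n - 1, by omega⟩
      rw [LinearMap.mem_ker] at hv ⊢
      simp [pow_succ, hv]
    exact ⟨hinj, LinearMap.injective_iff_surjective.1 hinj⟩
  · left
    have hB : LinearMap.range (f.toLinearMap ^ n : Module.End k V) = ⊥ :=
      congrArg Subrepresentation.toSubmodule hB
    exact ⟨n, LinearMap.range_eq_bot.1 hB⟩

/-- Subtracting an eigenvalue destroys injectivity, so Fitting's lemma leaves only nilpotence. -/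
theorem IsIndecomposable.exists_isNilpotent_sub [IsAlgClosed k] [Module.Finite k V]
    (h : IsIndecomposable ρ) (f : ρ.IntertwiningMap ρ) :
    ∃ a : k, IsNilpotent (f.toLinearMap - algebraMap k (Module.End k V) a) := by
  have := h.1
  obtain ⟨a, ha⟩ := Module.End.exists_eigenvalue (f.toLinearMap : Module.End k V)
  refine ⟨a, (h.isNilpotent_or_isUnit (f - a • .id ρ)).resolve_right fun hb => ?_⟩
  obtain ⟨v, hv⟩ := ha.exists_hasEigenvector
  refine hv.2 (hb.1 ?_)
  have := hv.apply_eq_smul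
  simp only [map_zero]
  change f.toLinearMap v - a • v = 0
  rw [this, sub_self]

/-- A representation is a direct summand of any representation through which one of its
automorphisms factors. -/
theorem isSummand_of_bijective (i : σ.IntertwiningMap ρ) (r : ρ.IntertwiningMap σ)
    (h : Function.Bijective (r.comp i)) : IsSummand σ ρ := by
  let e := IntertwiningMap.ofBijective (r.comp i) h
  refine ⟨i, e.symm.toIntertwiningMap.comp r, fun x => ?_⟩
  exact e.symm_apply_apply x

/-- The range of `i` and the kernel of `r` are complementary in `ρ`, and the range is nonzero, so
the kernel vanishes. -/
theorem IsIndecomposable.equiv_of_isSummand (hσ : IsIndecomposable σ) (hρ : IsIndecomposable ρ)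
    (h : IsSummand σ ρ) : Nonempty (σ.Equiv ρ) := by
  obtain ⟨i, r, h⟩ := h
  have hr : IsCompl i.range r.ker := by
    constructor
    · rw [disjoint_iff, eq_bot_iff]
      rintro _ ⟨⟨x, rfl⟩, hx⟩
      have : r (i x) = 0 := hx
      rw [h] at this
      subst this
      exact (Submodule.mem_bot k).2 (map_zero i.toLinearMap)
    · rw [codisjoint_iff, eq_top_iff]
      intro x _
      refine Submodule.mem_sup.2 ⟨i (r x), ⟨r x, rfl⟩, x - i (r x), ?_, by simp⟩
      change r (x - i (r x)) = 0
      rw [map_sub, h, sub_self]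
  have := hσ.1
  rcases hρ.2 _ _ hr with h0 | h0
  · obtain ⟨x, hx⟩ := exists_ne (0 : W)
    have : i x ∈ (⊥ : Subrepresentation ρ) := h0 ▸ ⟨x, rfl⟩
    have : i x = 0 := this
    exact absurd (by rw [← h x, this, map_zero]) hx
  · refine ⟨IntertwiningMap.ofBijective i ⟨fun x y hxy => by rw [← h x, hxy, h], fun x => ⟨r x, ?_⟩⟩⟩
    have : x - i (r x) ∈ (⊥ : Subrepresentation ρ) := by
      rw [← h0]
      change r (x - i (r x)) = 0
      rw [map_sub, h, sub_self]
    exact (sub_eq_zero.1 this).symm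

end Indecomposable

/-! ### Relative projectivity and Sylow vertices -/

section Vertices

variable {p : ℕ} [Fact p.Prime] {k : Type u} [Field k] [CharP k p] {G : Type v} [Group G]
  [Finite G] {V : Type w} [AddCommGroup V] [Module k V] {W : Type w'} [AddCommGroup W] [Module k W]
  {ρ : Representation k G V} {σ : Representation k G W}

/-- The index of `P` is invertible in `k`, so the identity is the relative trace of its scalar
multiple by the inverse. -/
theorem isRelProjective_sylow (P : Sylow p G) : IsRelProjective (P : Subgroup G) ρ := by
  have := Fintype.ofFinite (G ⧸ (P : Subgroup G))
  rw [isRelProjective_iff]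
  have hn : ((P : Subgroup G).index : k) ≠ 0 := by
    rw [Ne, CharP.cast_eq_zero_iff k p]
    exact P.not_dvd_index
  refine ⟨fun _ => ((P : Subgroup G).index : k)⁻¹ • LinearMap.id, fun g q => ?_, ?_⟩
  · ext v; simp
  · rw [Finset.sum_const, Finset.card_univ, ← Nat.card_eq_fintype_card, ← Subgroup.index,
      ← Nat.cast_smul_eq_nsmul k, smul_smul, mul_inv_cancel₀ hn, one_smul]

omit [Fact p.Prime] [CharP k p] in
theorem IsRelProjective.isTraceProjective {Q : Subgroup G} (hQ : IsNonSylow p Q)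
    (h : IsRelProjective Q ρ) : IsTraceProjective p ρ := by
  have := Fintype.ofFinite (G ⧸ Q)
  obtain ⟨f, hf, hsum⟩ := (isRelProjective_iff Q).1 h
  rw [IsTraceProjective, ← hsum]
  refine sum_mem_relTrace (fun q => ?_) hf
  induction q using QuotientGroup.induction_on with | _ g
  rw [stabilizer_quotient_mk]
  exact hQ.conj g

/-- If a Sylow subgroup is not minimal for relative projectivity, a proper subgroup of it works as
well, and that subgroup is non-Sylow. -/
theorem isTraceProjective_of_not_hasSylowVertex (h : ¬ HasSylowVertex p ρ) :
    IsTraceProjective p ρ := by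
  obtain ⟨P⟩ : Nonempty (Sylow p G) := inferInstance
  have : ¬ Minimal (fun K : Subgroup G => IsRelProjective K ρ) (P : Subgroup G) := fun hP => h ⟨P, hP⟩
  obtain ⟨Q, hQP, hQ⟩ := exists_lt_of_not_minimal
    (P := fun K : Subgroup G => IsRelProjective K ρ) (isRelProjective_sylow (ρ := ρ) P) this
  exact hQ.isTraceProjective (isNonSylow_of_lt hQP)

end Vertices

/-! ### Locality of endomorphism rings and Sylow-vertex components -/

section Vertices

variable {p : ℕ} [Fact p.Prime] {k : Type u} [Field k] [CharP k p] {G : Type v} [Group G]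
  [Finite G] {V : Type w} [AddCommGroup V] [Module k V] {W : Type w'} [AddCommGroup W] [Module k W]
  {ρ : Representation k G V} {σ : Representation k G W}

omit [Finite G] [Fact p.Prime] [CharP k p] in
-- After dividing by `a + b` the two maps sum to `1`; if one is nilpotent, the other is a unit.
theorem IsIndecomposable.bijective_of_add [Module.Finite k V] (h : IsIndecomposable ρ)
    (a b : ρ.IntertwiningMap ρ) (hab : Function.Bijective (a + b)) :
    Function.Bijective a ∨ Function.Bijective b := by
  let e := IntertwiningMap.ofBijective (a + b) hab
  have hes (v : V) : e.symm (a v + b v) = v := e.symm_apply_apply v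
  rcases h.isNilpotent_or_isUnit (e.symm.toIntertwiningMap.comp a) with hn | hb
  · right
    have hu := hn.isUnit_one_sub
    rw [Module.End.isUnit_iff] at hu
    have : (1 - (e.symm.toIntertwiningMap.comp a).toLinearMap : Module.End k V) =
        (e.symm.toIntertwiningMap.comp b).toLinearMap := by
      rw [sub_eq_iff_eq_add']
      ext v
      have := hes v
      rw [map_add] at this
      exact this.symm
    rw [this] at hu
    exact (Function.Bijective.of_comp_iff' e.symm.bijective b).1 hu
  · left
    exact (Function.Bijective.of_comp_iff' e.symm.bijective a).1 hb

omit [Finite G] [Fact p.Prime] [CharP k p] in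
theorem IsIndecomposable.exists_bijective_of_sum [Module.Finite k V] (h : IsIndecomposable ρ)
    {ι : Type*} (s : Finset ι) (f : ι → ρ.IntertwiningMap ρ)
    (hf : Function.Bijective (∑ i ∈ s, f i : ρ.IntertwiningMap ρ)) :
    ∃ i ∈ s, Function.Bijective (f i) := by
  classical
  induction s using Finset.induction_on with
  | empty =>
    have := h.1
    obtain ⟨x, hx⟩ := exists_ne (0 : V)
    exact absurd (hf.1 (a₁ := x) (a₂ := 0) (by simp)) hx
  | insert a s ha ih =>
    rw [Finset.sum_insert ha] at hf
    rcases h.bijective_of_add _ _ hf with h | h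
    · exact ⟨a, by simp, h⟩
    · obtain ⟨i, hi, h⟩ := ih h
      exact ⟨i, by simp [hi], h⟩

omit [Fact p.Prime] [CharP k p] in
theorem IsRelProjective.stabilizer {H : Subgroup G} (h : IsRelProjective H ρ) (q : G ⧸ H) :
    IsRelProjective (MulAction.stabilizer G q) ρ := by
  have := Fintype.ofFinite (G ⧸ H)
  have := Fintype.ofFinite (G ⧸ MulAction.stabilizer G q)
  obtain ⟨f, hf, hsum⟩ := (isRelProjective_iff H).1 h
  rw [isRelProjective_iff]
  have hb : Function.Bijective (MulAction.ofQuotientStabilizer G q) := by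
    refine ⟨MulAction.injective_ofQuotientStabilizer G q, fun r => ?_⟩
    obtain ⟨g, rfl⟩ := MulAction.exists_smul_eq G q r
    exact ⟨g, rfl⟩
  refine ⟨f ∘ MulAction.ofQuotientStabilizer G q, fun g x => ?_, ?_⟩
  · rw [Function.comp_apply, MulAction.ofQuotientStabilizer_smul, hf]
    rfl
  · rw [← hsum]
    exact hb.sum_comp f

omit [Fact p.Prime] [CharP k p] in
-- Grouping the traces by conjugacy class writes the identity as a sum of equivariant maps. By
-- locality one of them is an automorphism, and dividing by it turns a single relative trace into
-- the identity.
theorem IsTraceProjective.exists_isRelProjective [Module.Finite k V] (h : IsIndecomposable ρ)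
    (hρ : IsTraceProjective p ρ) :
    ∃ c : Quotient (nonSylowConj p G), IsRelProjective (repSubgroup c) ρ := by
  obtain ⟨f, hf, hsum⟩ := hρ
  have hf' (c : Quotient (nonSylowConj p G)) (g : G) (q : G ⧸ repSubgroup c) :
      f ⟨c, g • q⟩ = linHom ρ ρ g (f ⟨c, q⟩) := hf g ⟨c, q⟩
  let F (c : Quotient (nonSylowConj p G)) : ρ.IntertwiningMap ρ :=
    toIntertwining (∑ q : G ⧸ repSubgroup c, f ⟨c, q⟩) fun g v => by
      simp only [LinearMap.sum_apply, map_sum]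
      rw [← Equiv.sum_comp (MulAction.toPerm g)]
      simp [hf' c g]
  have hF : (∑ c, F c : ρ.IntertwiningMap ρ) = .id ρ := by
    ext v
    rw [Fintype.sum_sigma] at hsum
    refine Eq.trans ?_ (LinearMap.congr_fun hsum v)
    rw [IntertwiningMap.toLinearMap_sum, LinearMap.sum_apply, LinearMap.sum_apply]
    rfl
  obtain ⟨c, -, hc⟩ := h.exists_bijective_of_sum Finset.univ F (by
    rw [hF]; exact Function.bijective_id)
  refine ⟨c, (isRelProjective_iff _).2 ?_⟩
  let e := IntertwiningMap.ofBijective (F c) hc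
  refine ⟨linHomMap (.id ρ) e.symm.toIntertwiningMap ∘ fun q => f ⟨c, q⟩,
    IsEquivariant.comp (ρ := linHom ρ ρ) (f := fun q => f ⟨c, q⟩) (hf' c) _, ?_⟩
  simp only [Function.comp_apply]
  rw [← map_sum]
  ext v
  exact e.symm_apply_apply v

omit [CharP k p] in
-- A conjugate of the non-Sylow subgroup supplied by `IsTraceProjective.exists_isRelProjective` lies
-- in the Sylow vertex, and minimality would force equality.
theorem IsTraceProjective.not_hasSylowVertex [Module.Finite k V] (h : IsIndecomposable ρ)
    (hρ : IsTraceProjective p ρ) : ¬ HasSylowVertex p ρ := by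
  rintro ⟨P, hP⟩
  obtain ⟨c, hc⟩ := hρ.exists_isRelProjective h
  obtain ⟨P', hP'⟩ := (isNonSylow_repSubgroup c).1.exists_le_sylow
  obtain ⟨g, rfl⟩ := MulAction.exists_smul_eq G P' P
  have h1 := hc.stabilizer ((g : G) : G ⧸ repSubgroup c)
  rw [stabilizer_quotient_mk] at h1
  have h2 := (isNonSylow_repSubgroup c).conj g
  have h3 : (repSubgroup c).map (MulAut.conj g).toMonoidHom ≤ (g • P' : Sylow p G) :=
    Subgroup.map_mono hP'
  exact h2.2 (g • P') (le_antisymm (hP.2 h1 h3) h3)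

omit [Finite G] [Fact p.Prime] [CharP k p] in
/-- Complementary subrepresentations are direct summands. -/
theorem isSummand_of_isCompl {A B : Subrepresentation ρ} (h : IsCompl A B) :
    ∃ (i : A.toRepresentation.IntertwiningMap ρ) (r : ρ.IntertwiningMap A.toRepresentation)
      (j : B.toRepresentation.IntertwiningMap ρ) (s : ρ.IntertwiningMap B.toRepresentation),
      (∀ x, r (i x) = x) ∧ (∀ x, s (j x) = x) ∧ ∀ x, i (r x) + j (s x) = x := by
  have hc : IsCompl A.toSubmodule B.toSubmodule := by
    constructor
    · rw [disjoint_iff]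
      exact congrArg Subrepresentation.toSubmodule h.inf_eq_bot
    · rw [codisjoint_iff]
      exact congrArg Subrepresentation.toSubmodule h.sup_eq_top
  have key {A B : Subrepresentation ρ} (hc : IsCompl A.toSubmodule B.toSubmodule) (g : G) (v : V) :
      A.toSubmodule.projectionOnto B.toSubmodule hc (ρ g v) =
        A.toRepresentation g (A.toSubmodule.projectionOnto B.toSubmodule hc v) := by
    obtain ⟨a, ha, b, hb, rfl⟩ := Submodule.mem_sup.1 (hc.sup_eq_top ▸ Submodule.mem_top (x := v))
    rw [map_add, map_add, map_add,
      Submodule.projectionOnto_apply_of_mem_left hc (A.apply_mem_toSubmodule g ha),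
      Submodule.projectionOnto_apply_of_mem_right hc (B.apply_mem_toSubmodule g hb),
      Submodule.projectionOnto_apply_of_mem_left hc ha,
      Submodule.projectionOnto_apply_of_mem_right hc hb, add_zero, add_zero]
    rfl
  refine ⟨toIntertwining A.toSubmodule.subtype fun g v => rfl, toIntertwining _ (key hc),
    toIntertwining B.toSubmodule.subtype fun g v => rfl, toIntertwining _ (key hc.symm),
    fun x => ?_, fun x => ?_, fun x => ?_⟩
  · exact Submodule.projectionOnto_apply_left hc x
  · exact Submodule.projectionOnto_apply_left hc.symm x
  · exact Submodule.projection_add_projection_eq_self hc x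

omit [Fact p.Prime] [CharP k p] [Finite G] in
theorem exists_isCompl_of_not_isIndecomposable [Module.Finite k V] [Nontrivial V]
    (h : ¬ IsIndecomposable ρ) :
    ∃ A B : Subrepresentation ρ, IsCompl A B ∧
      Module.finrank k A.toSubmodule < Module.finrank k V ∧
      Module.finrank k B.toSubmodule < Module.finrank k V := by
  simp only [IsIndecomposable, ‹Nontrivial V›, true_and, not_forall, not_or] at h
  obtain ⟨A, B, hAB, hA, hB⟩ := h
  have hlt {A : Subrepresentation ρ} {B : Subrepresentation ρ} (hAB : IsCompl A B) (hB : B ≠ ⊥) :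
      Module.finrank k A.toSubmodule < Module.finrank k V := by
    refine Submodule.finrank_lt fun hA => hB ?_
    have hA : A = ⊤ := Subrepresentation.toSubmodule_injective hA
    rw [← hAB.inf_eq_bot, hA, top_inf_eq]
  exact ⟨A, B, hAB, hlt hAB hB, hlt hAB.symm hA⟩

theorem isTraceProjective_of_noSylowVertexComponent {V : Type w} [AddCommGroup V] [Module k V]
    [Module.Finite k V] {ρ : Representation k G V}
    (h : NoSylowVertexComponent p ρ) : IsTraceProjective p ρ := by
  induction hn : Module.finrank k V using Nat.strong_induction_on generalizing V with
  | _ n ih =>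
  subst hn
  by_cases hi : IsIndecomposable ρ
  · exact isTraceProjective_of_not_hasSylowVertex (h (Rep.of ρ) ⟨hi, .refl⟩)
  by_cases hV : Nontrivial V
  · obtain ⟨A, B, hAB, hA, hB⟩ := exists_isCompl_of_not_isIndecomposable hi
    obtain ⟨i, r, j, s, hi, hj, hsum⟩ := isSummand_of_isCompl hAB
    have hTA := ih _ hA (ρ := A.toRepresentation)
      (fun U hU => h U ⟨hU.1, hU.2.trans ⟨i, r, hi⟩⟩) rfl
    have hTB := ih _ hB (ρ := B.toRepresentation)
      (fun U hU => h U ⟨hU.1, hU.2.trans ⟨j, s, hj⟩⟩) rfl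
    have hp := hTA.prod hTB
    refine hp.of_isSummand ⟨r.prod s, (i.comp (IntertwiningMap.fst k _ _)) +
      (j.comp (IntertwiningMap.snd k _ _)), fun x => ?_⟩
    exact hsum x
  · rw [not_nontrivial_iff_subsingleton] at hV
    have : (LinearMap.id : V →ₗ[k] V) = 0 := Subsingleton.elim _ _
    rw [IsTraceProjective, this]
    exact Submodule.zero_mem _

theorem noSylowVertexComponent_iff [Module.Finite k V] :
    NoSylowVertexComponent p ρ ↔ IsTraceProjective p ρ :=
  ⟨isTraceProjective_of_noSylowVertexComponent, fun h U hU => by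
    have : Module.Finite k U := hU.2.finite
    exact (h.of_isSummand hU.2).not_hasSylowVertex hU.1⟩

theorem hasSylowVertexComponent_iff [Module.Finite k V] :
    HasSylowVertexComponent p ρ ↔ ¬ IsTraceProjective p ρ := by
  rw [← noSylowVertexComponent_iff]
  simp [HasSylowVertexComponent, NoSylowVertexComponent]

theorem hasSylowVertex_iff [Module.Finite k V] (h : IsIndecomposable ρ) :
    HasSylowVertex p ρ ↔ ¬ IsTraceProjective p ρ :=
  ⟨fun h1 h2 => h2.not_hasSylowVertex h h1,
    fun h1 => by_contra fun h2 => h1 (isTraceProjective_of_not_hasSylowVertex h2)⟩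

end Vertices

/-! ### The trace pairing on Hom-modules -/

section TraceDuality

variable {k : Type*} [Field k] {G : Type*} [Group G]
  {V W X : Type*} [AddCommGroup V] [Module k V] [Module.Finite k V]
  [AddCommGroup W] [Module k W] [Module.Finite k W] [AddCommGroup X] [Module k X]
  [Module.Finite k X]
  {ρ : Representation k G V} {σ : Representation k G W} {τ : Representation k G X}

/-- The trace pairing identifies `Hom(N, M)` with the dual of `Hom(M, N)`. -/
theorem exists_trace_equiv (ρ : Representation k G V) (σ : Representation k G W) :
    ∃ e : (linHom σ ρ).Equiv (linHom (linHom ρ σ) (trivial k G k)),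
      ∀ (b : W →ₗ[k] V) (a : V →ₗ[k] W), e b a = LinearMap.trace k V (b ∘ₗ a) := by
  let T : (W →ₗ[k] V) →ₗ[k] (V →ₗ[k] W) →ₗ[k] k :=
    LinearMap.mk₂ k (fun b a => LinearMap.trace k V (b ∘ₗ a))
      (by simp [LinearMap.add_comp]) (by simp [LinearMap.smul_comp])
      (by simp [LinearMap.comp_add]) (by simp [LinearMap.comp_smul])
  have hinj : Function.Injective T := by
    rw [← LinearMap.ker_eq_bot, LinearMap.ker_eq_bot']
    intro b hb
    ext w
    refine (Module.forall_dual_apply_eq_zero_iff k _).1 fun φ => ?_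
    have := congr($hb (φ.smulRight w))
    have e : b ∘ₗ φ.smulRight w = φ.smulRight (b w) := by ext; simp
    simpa [T, e, LinearMap.trace_smulRight] using this
  have hd : Module.finrank k (W →ₗ[k] V) = Module.finrank k ((V →ₗ[k] W) →ₗ[k] k) := by
    simp [Module.finrank_linearMap, mul_comm]
  refine ⟨toEquiv (LinearEquiv.ofBijective T ⟨hinj,
    (LinearMap.injective_iff_surjective_of_finrank_eq_finrank hd).1 hinj⟩) fun g b => ?_,
    fun b a => rfl⟩
  ext a
  change LinearMap.trace k V ((ρ g ∘ₗ b ∘ₗ σ g⁻¹) ∘ₗ a) =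
    LinearMap.trace k V (b ∘ₗ (σ g⁻¹ ∘ₗ a ∘ₗ ρ g⁻¹⁻¹))
  rw [LinearMap.comp_assoc, LinearMap.trace_comp_comm']
  simp [LinearMap.comp_assoc]

/-- Every invariant linear form on `Hom(M, N)` is the trace pairing with an equivariant map. -/
theorem exists_trace_eq (φ : (linHom ρ σ).IntertwiningMap (trivial k G k)) :
    ∃ b : σ.IntertwiningMap ρ, ∀ a : V →ₗ[k] W,
      φ a = LinearMap.trace k V (b.toLinearMap ∘ₗ a) := by
  obtain ⟨e, he⟩ := exists_trace_equiv ρ σ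
  have hb (g : G) : linHom σ ρ g (e.symm φ.toLinearMap) = e.symm φ.toLinearMap := by
    have := IntertwiningMap.isIntertwining _ _ e.symm.toIntertwiningMap g φ.toLinearMap
    have h : linHom (linHom ρ σ) (trivial k G k) g φ.toLinearMap = φ.toLinearMap := by
      ext a
      simpa using IntertwiningMap.isIntertwining _ _ φ g⁻¹ a
    exact this.symm.trans (congrArg e.symm h)
  refine ⟨toIntertwining (e.symm φ.toLinearMap) fun g w => ?_, fun a => ?_⟩
  · conv_lhs => rw [← hb g]
    simp
  · rw [← he]
    exact congr($((e.apply_symm_apply φ.toLinearMap).symm) a)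

theorem IsGood.linHom_swap {p : ℕ} (h : IsGood p (linHom ρ σ)) : IsGood p (linHom σ ρ) := by
  obtain ⟨e, -⟩ := exists_trace_equiv ρ σ
  exact h.dual.of_isSummand (.of_equiv e)

/-- If the dimension of `N` is invertible in `k`, then `Hom(M, L)` is a direct summand of
`Hom(N, L) ⊗ Hom(M, N)`. -/
theorem isSummand_linHom_tprod_linHom (hW : (Module.finrank k W : k) ≠ 0) :
    IsSummand (linHom ρ τ) ((linHom σ τ).tprod (linHom ρ σ)) := by
  -- The normalized trace splits `k → End(N)`, since `dim N` is invertible.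
  have h1 : IsSummand (linHom ρ τ) ((linHom σ σ).tprod (linHom ρ τ)) := by
    refine ⟨toIntertwining (TensorProduct.mk k _ _ LinearMap.id) fun g f => ?_,
      toIntertwining ((Module.finrank k W : k)⁻¹ • TensorProduct.lift
        ((LinearMap.trace k W).smulRight LinearMap.id)) fun g x => ?_, fun x => ?_⟩
    · have : σ g ∘ₗ σ g⁻¹ = LinearMap.id := by ext; simp
      simp [this]
    · induction x with
      | zero => simp
      | add x y hx hy => simp only [map_add, hx, hy]
      | tmul a b =>
        have : LinearMap.trace k W (σ g ∘ₗ a ∘ₗ σ g⁻¹) = LinearMap.trace k W a :=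
          IntertwiningMap.isIntertwining _ _ (traceMap σ) g a
        simp [this]
    · change (Module.finrank k W : k)⁻¹ • (TensorProduct.lift
        ((LinearMap.trace k W).smulRight LinearMap.id)) (LinearMap.id ⊗ₜ x) = x
      simp [smul_smul, hW]
  -- Swapping the target factors re-pairs `End(N) ⊗ Hom(M, L)` as `Hom(N, L) ⊗ Hom(M, N)`.
  have h2 : IsSummand (linHom (σ.tprod ρ) (σ.tprod τ)) (linHom (σ.tprod ρ) (τ.tprod σ)) :=
    .linHom_of_equiv (.refl _) tprodComm
  exact ((h1.trans (.of_equiv linHomTensorEquiv)).trans h2).trans (.of_equiv' linHomTensorEquiv)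

end TraceDuality

/-! ### Splitting off trivial summands -/

section Splitting

variable {k : Type u} [Field k] {G : Type v} [Group G]
  {V : Type w} [AddCommGroup V] [Module k V] {ρ : Representation k G V}

/-- An invariant vector on which an invariant linear form does not vanish splits off a trivial
direct summand. -/
def equivTrivialProdKer (φ : ρ.IntertwiningMap (trivial k G k)) (u : V) (hu : ∀ g, ρ g u = u)
    (h : φ u = 1) : ρ.Equiv ((trivial k G k).prod φ.ker.toRepresentation) :=
  toEquiv
    { toFun x := (φ x, ⟨x - φ x • u, show φ (x - φ x • u) = 0 by simp [h]⟩)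
      map_add' x y := by
        refine Prod.ext (map_add φ x y) (Subtype.ext ?_)
        change x + y - φ (x + y) • u = (x - φ x • u) + (y - φ y • u)
        rw [map_add, add_smul]
        abel
      map_smul' a x := by
        refine Prod.ext (map_smul φ a x) (Subtype.ext ?_)
        change a • x - φ (a • x) • u = a • (x - φ x • u)
        rw [map_smul, smul_sub, smul_smul, smul_eq_mul]
      invFun y := y.1 • u + y.2.1
      left_inv x := by simp
      right_inv y := by
        have hy : φ y.2.1 = 0 := y.2.2
        have h1 : φ (y.1 • u + y.2.1) = y.1 := by simp [h, hy]
        refine Prod.ext h1 (Subtype.ext ?_)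
        change y.1 • u + y.2.1 - φ (y.1 • u + y.2.1) • u = y.2.1
        rw [h1, add_sub_cancel_left] } fun g x => by
    have h1 : φ (ρ g x) = φ x := by
      simpa using IntertwiningMap.isIntertwining _ _ φ g x
    refine Prod.ext h1 (Subtype.ext ?_)
    change ρ g x - φ (ρ g x) • u = ρ g (x - φ x • u)
    rw [h1, map_sub, map_smul, hu]

variable {p : ℕ} [Finite G]

/-- A summand of a permutation module on a nice `G`-set is the direct sum of a trivial module and
a trace-projective `p`-permutation module. -/
theorem IsGood.exists_equiv {V : Type w} [AddCommGroup V] [Module k V] {ρ : Representation k G V}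
    (h : IsGood p ρ) : ∃ (n : ℕ) (W : Rep.{w} k G), IsGood p W.ρ ∧ IsTraceProjective p W.ρ ∧
      Nonempty (ρ.Equiv ((trivial k G (Fin n → k)).prod W.ρ)) := by
  have := h.finite
  induction hn : Module.finrank k V using Nat.strong_induction_on generalizing V with
  | _ n ih =>
  subst hn
  -- Either the main lemma applies with `n = 0`, or a nonzero pairing splits off a copy of `k` and
  -- the kernel of the form is handled by induction.
  by_cases h0 : ∀ u : V, (∀ g, ρ g u = u) → ∀ φ : ρ.IntertwiningMap (trivial k G k), φ u = 0
  · refine ⟨0, Rep.of ρ, h, h.isTraceProjective h0, ⟨toEquiv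
      (LinearEquiv.uniqueProd (R := k) (M := V) (M₂ := Fin 0 → k)).symm fun g x => ?_⟩⟩
    exact Prod.ext (Subsingleton.elim _ _) rfl
  · push Not at h0
    obtain ⟨u, hu, φ, hφ⟩ := h0
    let ψ : ρ.IntertwiningMap (trivial k G k) := (φ u)⁻¹ • φ
    have hψ : ψ u = 1 := by simp [ψ, hφ]
    let e := equivTrivialProdKer ψ u hu hψ
    have hlt : Module.finrank k ψ.ker.toSubmodule < Module.finrank k V := by
      refine Submodule.finrank_lt fun hk => ?_
      have : u ∈ ψ.ker.toSubmodule := hk ▸ Submodule.mem_top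
      have : ψ u = 0 := this
      simp [hψ] at this
    obtain ⟨n, W, hW, hWT, ⟨e'⟩⟩ := ih _ hlt (ρ := ψ.ker.toRepresentation)
      (h.of_isSummand (IsSummand.inr.trans (.of_equiv' e))) inferInstance rfl
    refine ⟨n + 1, W, hW, hWT, ⟨e.trans (toEquiv (((LinearEquiv.refl k k).prodCongr
      e'.toLinearEquiv).trans ((LinearEquiv.prodAssoc k k (Fin n → k) W).symm.trans
      ((Fin.consLinearEquiv k fun _ => k).prodCongr (.refl k W)))) fun g x => ?_)⟩⟩
    have := IntertwiningMap.isIntertwining _ _ e'.toIntertwiningMap g x.2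
    have h1 := congrArg Prod.fst this
    have h2 := congrArg Prod.snd this
    have h3 := congrArg (Fin.cons (α := fun _ : Fin (n + 1) => k) x.1) h1
    exact Prod.ext h3 h2

/-- The representation is the direct sum of the trivial representation and a trace-projective
one. -/
def IsTrivialPlusProjective (p : ℕ) (ρ : Representation k G V) : Prop :=
  ∃ W : Rep.{w} k G, IsTraceProjective p W.ρ ∧ Nonempty (ρ.Equiv ((trivial k G k).prod W.ρ))

theorem isTraceProjective_ker (φ : ρ.IntertwiningMap (trivial k G k)) (u : V)
    (hu : ∀ g, ρ g u = u) (h : φ u = 1)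
    (hT : LinearMap.id - φ.toLinearMap.smulRight u ∈ relTrace p (linHom ρ ρ)) :
    IsTraceProjective p φ.ker.toRepresentation := by
  let e := equivTrivialProdKer φ u hu h
  let i : φ.ker.toRepresentation.IntertwiningMap ρ :=
    toIntertwining φ.ker.toSubmodule.subtype fun _ _ => rfl
  let r : ρ.IntertwiningMap φ.ker.toRepresentation :=
    (IntertwiningMap.snd k (trivial k G k) φ.ker.toRepresentation).comp e.toIntertwiningMap
  have key : linHomMap i r (LinearMap.id - φ.toLinearMap.smulRight u) = LinearMap.id := by
    refine LinearMap.ext fun x => Subtype.ext ?_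
    have hx : φ x.1 = 0 := x.2
    change (x.1 - φ x.1 • u) - φ (x.1 - φ x.1 • u) • u = x.1
    simp [hx]
  have := map_mem_relTrace (linHomMap i r) hT
  rwa [key] at this

/-- This form avoids naming a complement: the idempotent killing the copy of `k` spanned by `u` must
lie in the trace ideal, which is easy to check on tensor products. -/
theorem isTrivialPlusProjective_iff : IsTrivialPlusProjective p ρ ↔
    ∃ (φ : ρ.IntertwiningMap (trivial k G k)) (u : V), (∀ g, ρ g u = u) ∧ φ u = 1 ∧
      LinearMap.id - φ.toLinearMap.smulRight u ∈ relTrace p (linHom ρ ρ) := by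
  constructor
  · rintro ⟨W, hW, ⟨e⟩⟩
    refine ⟨(IntertwiningMap.fst k _ _).comp e.toIntertwiningMap, e.symm (1, 0), fun g => ?_, ?_, ?_⟩
    · refine (IntertwiningMap.isIntertwining _ _ e.symm.toIntertwiningMap g (1, 0)).symm.trans ?_
      exact congrArg e.symm (by simp)
    · change (e (e.symm (1, 0))).1 = 1
      rw [e.apply_symm_apply]
    · have := map_mem_relTrace (linHomMap ((IntertwiningMap.snd k _ _).comp e.toIntertwiningMap)
        (e.symm.toIntertwiningMap.comp (IntertwiningMap.inr k (trivial k G k) _))) hW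
      refine Eq.mp (congrArg (· ∈ relTrace p (linHom ρ ρ)) ?_) this
      refine LinearMap.ext fun x => ?_
      change e.symm (0, (e x).2) = x - (e x).1 • e.symm (1, 0)
      rw [eq_sub_iff_add_eq, ← map_smul, ← map_add]
      simp
  · rintro ⟨φ, u, hu, h, hT⟩
    exact ⟨Rep.of φ.ker.toRepresentation, isTraceProjective_ker φ u hu h hT,
      ⟨equivTrivialProdKer φ u hu h⟩⟩

theorem IsTrivialPlusProjective.of_equiv {W : Type w} [AddCommGroup W] [Module k W]
    {σ : Representation k G W} (h : IsTrivialPlusProjective p ρ) (e : σ.Equiv ρ) :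
    IsTrivialPlusProjective p σ := by
  obtain ⟨U, hU, ⟨e'⟩⟩ := h
  exact ⟨U, hU, ⟨e.trans e'⟩⟩

theorem IsTrivialPlusProjective.tprod {W : Type w} [AddCommGroup W] [Module k W]
    {σ : Representation k G W} (h : IsTrivialPlusProjective p ρ)
    (h' : IsTrivialPlusProjective p σ) : IsTrivialPlusProjective p (ρ.tprod σ) := by
  rw [isTrivialPlusProjective_iff] at h h' ⊢
  obtain ⟨φ, u, hu, h, hT⟩ := h
  obtain ⟨φ', u', hu', h', hT'⟩ := h'
  let m : ((trivial k G k).tprod (trivial k G k)).IntertwiningMap (trivial k G k) :=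
    (trivialTprod (.refl k k)).toIntertwiningMap
  have hm (a b : k) : m (a ⊗ₜ b) = a * b := by
    change TensorProduct.lid k k (a ⊗ₜ b) = _
    simp
  refine ⟨m.comp (φ.tensor φ'), u ⊗ₜ u', fun g => by simp [hu, hu'], ?_, ?_⟩
  · rw [IntertwiningMap.comp_apply, IntertwiningMap.tensor_apply, hm, h, h', one_mul]
  · let R : (linHom ρ ρ).IntertwiningMap (linHom (ρ.tprod σ) (ρ.tprod σ)) :=
      toIntertwining (LinearMap.rTensorHom W) fun g f => by ext v w; simp
    let L : (linHom σ σ).IntertwiningMap (linHom (ρ.tprod σ) (ρ.tprod σ)) :=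
      toIntertwining (LinearMap.lTensorHom V) fun g f => by ext v w; simp
    have hφ (g : G) (x : V) : φ (ρ g x) = φ x := by
      simpa using IntertwiningMap.isIntertwining _ _ φ g x
    let P : ρ.IntertwiningMap ρ := toIntertwining (φ.toLinearMap.smulRight u) fun g x => by
      simp [hφ, hu]
    -- With `P`, `P'` the projections onto the trivial parts, `1 - P ⊗ P' = (1 - P) ⊗ 1 + P ⊗ (1 -
    -- P')`.
    have := Submodule.add_mem _ (map_mem_relTrace R hT)
      (map_mem_relTrace ((linHomMap (.id _) (P.tensor (.id σ))).comp L) hT')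
    refine Eq.mp (congrArg (· ∈ relTrace p (linHom (ρ.tprod σ) (ρ.tprod σ))) ?_) this
    ext x y
    change (x - φ x • u) ⊗ₜ[k] y + (φ x • u) ⊗ₜ[k] (y - φ' y • u') =
      x ⊗ₜ[k] y - m (φ x ⊗ₜ[k] φ' y) • (u ⊗ₜ[k] u')
    rw [hm, TensorProduct.sub_tmul, TensorProduct.tmul_sub, TensorProduct.smul_tmul_smul]
    abel

end Splitting

/-! ### Dimension, endotriviality and uniqueness of caps -/

section Caps

variable {p : ℕ} [Fact p.Prime] {k : Type u} [Field k] [CharP k p] {G : Type v}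
  [Group G] [Finite G] {V W X : Type*} [AddCommGroup V] [Module k V] [Module.Finite k V]
  [AddCommGroup W] [Module k W] [Module.Finite k W] [AddCommGroup X] [Module k X]
  [Module.Finite k X]
  {ρ : Representation k G V} {σ : Representation k G W} {τ : Representation k G X}

theorem IsTraceProjective.finrank_eq_zero (h : IsTraceProjective p ρ) :
    (Module.finrank k V : k) = 0 := by
  rw [← LinearMap.trace_id]
  exact trace_eq_zero_of_mem_relTrace h

omit [Fact p.Prime] [CharP k p] [Module.Finite k V] [Module.Finite k W] in
theorem IsTraceProjective.linHom (h : IsTraceProjective p ρ) :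
    IsTraceProjective p (linHom σ ρ) := by
  have := map_mem_relTrace (σ := Representation.linHom (Representation.linHom σ ρ)
    (Representation.linHom σ ρ)) (toIntertwining (LinearMap.llcomp k W V V)
    fun g f => by ext; simp) h
  exact this

omit [Finite G] [Fact p.Prime] [CharP k p] in
theorem IsIndecomposable.trace_eq [IsAlgClosed k] (h : IsIndecomposable ρ)
    (f : ρ.IntertwiningMap ρ) : ∃ a : k,
      IsNilpotent (f.toLinearMap - algebraMap k (Module.End k V) a) ∧
      LinearMap.trace k V f.toLinearMap = a * Module.finrank k V := by
  obtain ⟨a, ha⟩ := h.exists_isNilpotent_sub f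
  refine ⟨a, ha, ?_⟩
  have := (LinearMap.isNilpotent_trace_of_isNilpotent ha).eq_zero
  rw [map_sub, sub_eq_zero] at this
  rw [this, Algebra.algebraMap_eq_smul_one, map_smul, LinearMap.trace_one, smul_eq_mul]

omit [Finite G] in
/-- Intertwining maps as invariant vectors. -/
def ofInvariant (u : V →ₗ[k] W) (hu : ∀ g, linHom ρ σ g u = u) : ρ.IntertwiningMap σ :=
  toIntertwining u fun g v => by
    conv_lhs => rw [← hu g]
    simp

variable [IsAlgClosed k]

omit [Fact p.Prime] [CharP k p] in
/-- The dimension of a cap is prime to `p`. -/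
theorem IsIndecomposable.finrank_ne_zero (h : IsIndecomposable ρ)
    (hg : IsGood p (Representation.linHom ρ ρ)) (hT : ¬ IsTraceProjective p ρ) :
    (Module.finrank k V : k) ≠ 0 := by
  intro h0
  -- Each value `φ u` is the trace of an equivariant endomorphism, that is, a scalar times the
  -- dimension, which is zero by `h0`.
  refine hT (IsTraceProjective.of_linHom_self (hg.isTraceProjective fun u hu φ => ?_))
  obtain ⟨b, hb⟩ := exists_trace_eq φ
  obtain ⟨a, -, ha⟩ := h.trace_eq (b.comp (ofInvariant u hu))
  rw [h0, mul_zero] at ha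
  rw [hb]
  exact ha

omit [Fact p.Prime] [CharP k p] in
/-- Caps are endotrivial relative to the family of non-Sylow `p`-subgroups. -/
theorem IsIndecomposable.isTrivialPlusProjective (h : IsIndecomposable ρ)
    (hg : IsGood p (Representation.linHom ρ ρ)) (hT : ¬ IsTraceProjective p ρ) :
    IsTrivialPlusProjective p (Representation.linHom ρ ρ) := by
  have hd := h.finrank_ne_zero hg hT
  let φ : (Representation.linHom ρ ρ).IntertwiningMap (trivial k G k) :=
    (Module.finrank k V : k)⁻¹ • traceMap ρ
  have hφ (f : V →ₗ[k] V) : φ f = (Module.finrank k V : k)⁻¹ * LinearMap.trace k V f := rfl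
  have hid (g : G) : Representation.linHom ρ ρ g LinearMap.id = LinearMap.id := by ext; simp
  have h1 : φ LinearMap.id = 1 := by rw [hφ, LinearMap.trace_id, inv_mul_cancel₀ hd]
  let e := equivTrivialProdKer φ LinearMap.id hid h1
  refine ⟨Rep.of φ.ker.toRepresentation, ?_, ⟨e⟩⟩
  -- An invariant `u` of trace zero is nilpotent because the dimension is invertible. Then no `b ∘
  -- u` is an automorphism, so each is nilpotent and has trace zero.
  refine (hg.of_isSummand (IsSummand.inr.trans (.of_equiv' e))).isTraceProjective fun u hu ψ => ?_
  have hu0 : LinearMap.trace k V u.1 = 0 := by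
    have : φ u.1 = 0 := u.2
    rw [hφ] at this
    exact (mul_eq_zero.1 this).resolve_left (inv_ne_zero hd)
  let u' := ofInvariant u.1 fun g => congrArg Subtype.val (hu g)
  obtain ⟨b, hb⟩ := exists_trace_eq (ψ.comp ((IntertwiningMap.snd k _ _).comp e.toIntertwiningMap))
  have hψ : ψ u = LinearMap.trace k V (b.toLinearMap ∘ₗ u.1) := by
    rw [← hb]
    refine congrArg ψ (Subtype.ext ?_)
    change u.1 = u.1 - φ u.1 • LinearMap.id
    rw [show φ u.1 = 0 from u.2, zero_smul, sub_zero]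
  obtain ⟨a, hn, ha⟩ := h.trace_eq u'
  have ha0 : a = 0 := by
    rw [show LinearMap.trace k V u'.toLinearMap = 0 from hu0, eq_comm] at ha
    exact (mul_eq_zero.1 ha).resolve_right hd
  rw [ha0, map_zero, sub_zero] at hn
  rw [hψ]
  rcases h.isNilpotent_or_isUnit (b.comp u') with hbu | hbu
  · exact (LinearMap.isNilpotent_trace_of_isNilpotent hbu).eq_zero
  · exfalso
    have hinj : Function.Injective u'.toLinearMap := Function.Injective.of_comp hbu.1
    have hub : IsUnit (u'.toLinearMap : Module.End k V) := (Module.End.isUnit_iff _).2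
      ⟨hinj, LinearMap.injective_iff_surjective.1 hinj⟩
    have := h.1
    exact hn.not_isUnit hub

omit [Fact p.Prime] [CharP k p] in
/-- The caps of a Dade module are isomorphic. -/
theorem IsIndecomposable.nonempty_equiv (hρ : IsIndecomposable ρ) (hσ : IsIndecomposable σ)
    (hg : IsGood p (Representation.linHom ρ ρ)) (hg' : IsGood p (Representation.linHom ρ σ))
    (hT : ¬ IsTraceProjective p ρ) (hT' : ¬ IsTraceProjective p σ) : Nonempty (ρ.Equiv σ) := by
  by_contra hne
  -- Without an isomorphism, every composite `ρ → σ → ρ` is nilpotent, so all the pairings vanish.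
  have hH : IsTraceProjective p (Representation.linHom ρ σ) :=
    hg'.isTraceProjective fun u hu φ => by
      obtain ⟨b, hb⟩ := exists_trace_eq φ
      rw [hb]
      rcases hρ.isNilpotent_or_isUnit (b.comp (ofInvariant u hu)) with h | h
      · exact (LinearMap.isNilpotent_trace_of_isNilpotent h).eq_zero
      · exact absurd (hρ.equiv_of_isSummand hσ (isSummand_of_bijective _ _ h)) hne
  refine hT' ?_
  -- As `dim ρ` is invertible, `σ ≅ Hom(k, σ)` is a summand of a tensor product with the
  -- trace-projective `Hom(ρ, σ)`.
  have h1 : IsSummand (Representation.linHom (trivial k G k) σ)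
      ((Representation.linHom ρ σ).tprod (Representation.linHom (trivial k G k) ρ)) :=
    isSummand_linHom_tprod_linHom (hρ.finrank_ne_zero hg hT)
  exact (hH.tprod_left.of_isSummand h1).of_isSummand (.of_equiv' (linHomTrivial (.refl k k)))

end Caps

/-! ### Goodness of Hom-modules and duals -/

section Hom

variable {p : ℕ} {k : Type u} [Field k] {G : Type v}
  [Group G] {V W X Y : Type*} [AddCommGroup V] [Module k V]
  [AddCommGroup W] [Module k W] [AddCommGroup X] [Module k X] [AddCommGroup Y] [Module k Y]
  {ρ : Representation k G V} {σ : Representation k G W} {τ : Representation k G X}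
  {π : Representation k G Y}

theorem IsGood.linHom_prod_left (h : IsGood p (linHom ρ τ)) (h' : IsGood p (linHom σ τ)) :
    IsGood p (linHom (ρ.prod σ) τ) := by
  refine (h.prod h').of_isSummand
    ⟨(linHomMap (IntertwiningMap.inl k ρ σ) (.id τ)).prod
      (linHomMap (IntertwiningMap.inr k ρ σ) (.id τ)),
    (linHomMap (IntertwiningMap.fst k ρ σ) (.id τ)).comp (IntertwiningMap.fst k _ _) +
      (linHomMap (IntertwiningMap.snd k ρ σ) (.id τ)).comp (IntertwiningMap.snd k _ _),
    fun f => LinearMap.ext fun x => ?_⟩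
  change f (x.1, 0) + f (0, x.2) = f x
  rw [← map_add]
  simp

theorem IsGood.linHom_prod_right (h : IsGood p (linHom τ ρ)) (h' : IsGood p (linHom τ σ)) :
    IsGood p (linHom τ (ρ.prod σ)) := by
  refine (h.prod h').of_isSummand
    ⟨(linHomMap (.id τ) (IntertwiningMap.fst k ρ σ)).prod
      (linHomMap (.id τ) (IntertwiningMap.snd k ρ σ)),
    (linHomMap (.id τ) (IntertwiningMap.inl k ρ σ)).comp (IntertwiningMap.fst k _ _) +
      (linHomMap (.id τ) (IntertwiningMap.inr k ρ σ)).comp (IntertwiningMap.snd k _ _),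
    fun f => LinearMap.ext fun x => ?_⟩
  change ((f x).1, 0) + (0, (f x).2) = f x
  simp

theorem IsGood.linHom_of_equiv (h : IsGood p (linHom ρ ρ)) (e : ρ.Equiv σ) :
    IsGood p (linHom ρ σ) :=
  h.of_isSummand (.linHom_of_equiv (.refl ρ) e.symm)

variable [Module.Finite k V] [Module.Finite k W] [Module.Finite k X] [Module.Finite k Y]

theorem IsGood.linHom_tprod (h : IsGood p (linHom ρ τ)) (h' : IsGood p (linHom σ π)) :
    IsGood p (linHom (ρ.tprod σ) (τ.tprod π)) :=
  (h.tprod h').of_equiv linHomTensorEquiv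

/-- Of the four blocks of `End(M ⊕ N)`, the diagonal ones are good by hypothesis and the
off-diagonal ones are dual to each other. -/
theorem isGood_linHom_prod_iff (hρ : IsGood p (linHom ρ ρ)) (hσ : IsGood p (linHom σ σ)) :
    IsGood p (linHom (ρ.prod σ) (ρ.prod σ)) ↔ IsGood p (linHom ρ σ) :=
  ⟨fun h => h.of_isSummand (.linHom .inl .inr), fun h =>
    (hρ.linHom_prod_right h).linHom_prod_left (h.linHom_swap.linHom_prod_right hσ)⟩

/-- The dual representation. -/
def dualRep {V : Type w} [AddCommGroup V] [Module k V] (ρ : Representation k G V) :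
    Rep.{max u w} k G := Rep.of (linHom ρ (trivial k G k))

instance : Module.Finite k (dualRep ρ) := inferInstanceAs (Module.Finite k (V →ₗ[k] k))

theorem finrank_dualRep : Module.finrank k (dualRep ρ) = Module.finrank k V :=
  (Module.finrank_linearMap k k V k).trans (by simp)

/-- The transpose identifies `Hom(M, N)` with `Hom(N*, M*)`. -/
theorem exists_transpose_equiv (ρ : Representation k G V) (σ : Representation k G W) :
    Nonempty ((linHom ρ σ).Equiv (linHom (dualRep σ).ρ (dualRep ρ).ρ)) := by
  let T : (V →ₗ[k] W) →ₗ[k] dualRep σ →ₗ[k] dualRep ρ := (LinearMap.llcomp k V W k).flip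
  have hinj : Function.Injective T := by
    intro f f' h
    ext v
    refine sub_eq_zero.1 ((Module.forall_dual_apply_eq_zero_iff k _).1 fun φ => ?_)
    rw [map_sub, sub_eq_zero]
    have h1 : φ ∘ₗ f = φ ∘ₗ f' := LinearMap.congr_fun h (show dualRep σ from φ)
    exact LinearMap.congr_fun h1 v
  have hd : Module.finrank k (V →ₗ[k] W) =
      Module.finrank k (dualRep σ →ₗ[k] dualRep ρ) := by
    simp [Module.finrank_linearMap, finrank_dualRep, mul_comm]
  refine ⟨toEquiv (LinearEquiv.ofBijective T ⟨hinj,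
    (LinearMap.injective_iff_surjective_of_finrank_eq_finrank hd).1 hinj⟩) fun g f => ?_⟩
  refine LinearMap.ext fun (φ : W →ₗ[k] k) => LinearMap.ext fun (v : V) => ?_
  change φ (σ g (f (ρ g⁻¹ v))) = φ (σ g⁻¹⁻¹ (f (ρ g⁻¹ v)))
  rw [inv_inv]

theorem IsGood.linHom_dualRep (h : IsGood p (linHom ρ σ)) :
    IsGood p (linHom (dualRep ρ).ρ (dualRep σ).ρ) := by
  obtain ⟨e⟩ := exists_transpose_equiv σ ρ
  exact h.linHom_swap.of_equiv e

variable (ρ W) in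
/-- `M* ⊗ N ≅ Hom(M, N)` linearly. -/
def dualTprodLinearEquiv : dualRep ρ ⊗[k] W ≃ₗ[k] (V →ₗ[k] W) := dualTensorHomEquiv k V W

omit [Module.Finite k W] in
theorem dualTprodLinearEquiv_tmul (φ : V →ₗ[k] k) (w : W) (v : V) :
    dualTprodLinearEquiv W ρ ((show dualRep ρ from φ) ⊗ₜ w) v = φ v • w := rfl

/-- `M* ⊗ N ≅ Hom(M, N)` equivariantly. -/
def dualTprodEquiv : ((dualRep ρ).ρ.tprod σ).Equiv (linHom ρ σ) :=
  toEquiv (dualTprodLinearEquiv W ρ) fun g x => by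
    induction x with
    | zero => simp only [map_zero]
    | add x y hx hy => simp only [map_add, hx, hy]
    | tmul φ w =>
      ext v
      refine (dualTprodLinearEquiv_tmul (ρ := ρ) (linHom ρ (trivial k G k) g φ) (σ g w) v).trans ?_
      rw [linHom_apply, LinearMap.comp_apply, LinearMap.comp_apply, dualTprodLinearEquiv_tmul φ w,
        map_smul]
      rfl

theorem IsTraceProjective.of_dualRep [Finite G] (h : IsTraceProjective p (dualRep ρ).ρ) :
    IsTraceProjective p ρ := by
  obtain ⟨e⟩ := exists_transpose_equiv ρ ρ
  exact .of_linHom_self ((h.linHom (σ := (dualRep ρ).ρ)).of_isSummand (.of_equiv e))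

end Hom

/-! ### Transitivity and tensor products through caps -/

section Transitivity

variable {p : ℕ} [Fact p.Prime] {k : Type u} [Field k] [CharP k p] [IsAlgClosed k] {G : Type v}
  [Group G] [Finite G] {V : Type w} {W : Type w'} {X : Type*} [AddCommGroup V] [Module k V]
  [AddCommGroup W] [Module k W] [Module.Finite k W] [AddCommGroup X] [Module k X]
  {ρ : Representation k G V} {σ : Representation k G W} {τ : Representation k G X}

/-- A component of dimension prime to `p` of a capped Dade module. -/
theorem exists_cap (hσ : IsGood p (linHom σ σ)) (hT : ¬ IsTraceProjective p σ) :
    ∃ U : Rep.{w'} k G, IsComponent U.ρ σ ∧ Module.Finite k U ∧ HasSylowVertex p U.ρ ∧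
      ¬ IsTraceProjective p U.ρ ∧ IsGood p (linHom U.ρ U.ρ) ∧ (Module.finrank k U : k) ≠ 0 := by
  obtain ⟨U, hU, hV⟩ := hasSylowVertexComponent_iff.2 hT
  have := hU.2.finite
  have hUT := (hasSylowVertex_iff hU.1).1 hV
  have hg := hσ.of_isSummand (.linHom hU.2 hU.2)
  exact ⟨U, hU, this, hV, hUT, hg, hU.1.finrank_ne_zero hg hUT⟩

/-- The middle module is replaced by its cap, whose dimension is invertible in `k`. -/
theorem IsGood.linHom_trans [Module.Finite k V] [Module.Finite k X] (hσ : IsGood p (linHom σ σ))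
    (hT : ¬ IsTraceProjective p σ)
    (h : IsGood p (linHom ρ σ)) (h' : IsGood p (linHom σ τ)) : IsGood p (linHom ρ τ) := by
  obtain ⟨U, hU, _, -, -, -, hd⟩ := exists_cap hσ hT
  exact ((h'.of_isSummand (.linHom hU.2 .refl)).tprod
    (h.of_isSummand (.linHom .refl hU.2))).of_isSummand (isSummand_linHom_tprod_linHom hd)

/-- The tensor product of two caps is a summand of dimension nonzero in `k`, whereas
trace-projective modules have dimension zero in `k`. -/
theorem not_isTraceProjective_tprod [Module.Finite k V] (hρ : IsGood p (linHom ρ ρ))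
    (hσ : IsGood p (linHom σ σ))
    (hT : ¬ IsTraceProjective p ρ) (hT' : ¬ IsTraceProjective p σ) :
    ¬ IsTraceProjective p (ρ.tprod σ) := by
  obtain ⟨U, hU, _, -, -, -, hd⟩ := exists_cap hρ hT
  obtain ⟨U', hU', _, -, -, -, hd'⟩ := exists_cap hσ hT'
  intro h
  have := (h.of_isSummand (hU.2.tprod hU'.2)).finrank_eq_zero
  rw [Module.finrank_tensorProduct, Nat.cast_mul] at this
  exact mul_ne_zero hd hd' this

end Transitivity

/-! ### Dade and strongly capped modules in terms of goodness -/

section Dade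

variable {p : ℕ} [Fact p.Prime] {k : Type u} [Field k] [CharP k p] {G : Type v}
  [Group G] [Finite G] {V : Type u} [AddCommGroup V] [Module k V] [Module.Finite k V]
  {ρ : Representation k G V}

/-- Trivial modules come from fixed points, and trace-projective `p`-permutation modules are good;
conversely `IsGood.exists_equiv` splits a good module into these two kinds. -/
theorem isDade_iff : IsDade p ρ ↔ IsGood p (linHom ρ ρ) := by
  constructor
  · rintro ⟨n, W, hW, hN, ⟨e⟩⟩
    have : Module.Finite k W := (IsSummand.inr.trans (.of_equiv' e)).finite
    exact (isGood_trivial.prod ((noSylowVertexComponent_iff.1 hN).isGood hW)).of_equiv e.symm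
  · intro h
    obtain ⟨n, W, hW, hWT, ⟨e⟩⟩ := h.exists_equiv
    have := hW.finite
    exact ⟨n, W, hW.isPPermutation, noSylowVertexComponent_iff.2 hWT, ⟨e⟩⟩

theorem isCappedDade_iff :
    IsCappedDade p ρ ↔ IsGood p (linHom ρ ρ) ∧ ¬ IsTraceProjective p ρ := by
  rw [IsCappedDade, isDade_iff, hasSylowVertexComponent_iff]

omit [Fact p.Prime] [CharP k p] in
theorem isStronglyCapped_iff : IsStronglyCapped p k G ρ ↔
    IsGood p (linHom ρ ρ) ∧ IsTrivialPlusProjective p (linHom ρ ρ) := by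
  constructor
  · rintro ⟨h, W, hW, ⟨e⟩⟩
    have hs : IsSummand W.ρ (linHom ρ ρ) := IsSummand.inr.trans (.of_equiv' e)
    have := hs.finite
    rw [isProjectiveRelTo_VF_iff] at hW
    exact ⟨(isGood_trivial.prod (hW.isGood (h.of_isSummand hs))).of_equiv e.symm, W, hW, ⟨e⟩⟩
  · rintro ⟨h, W, hW, ⟨e⟩⟩
    have hs : IsSummand W.ρ (linHom ρ ρ) := IsSummand.inr.trans (.of_equiv' e)
    have := hs.finite
    exact ⟨h.isPPermutation, W, isProjectiveRelTo_VF_iff.2 hW, ⟨e⟩⟩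

/-- If `M` were trace-projective, so would be `End(M)` and its summand `k`. -/
theorem IsStronglyCapped.isCappedDade (h : IsStronglyCapped p k G ρ) : IsCappedDade p ρ := by
  rw [isStronglyCapped_iff] at h
  rw [isCappedDade_iff]
  obtain ⟨h, W, -, ⟨e⟩⟩ := h
  refine ⟨h, fun hT => not_isTraceProjective_trivial (p := p) (k := k) (G := G) ?_⟩
  exact hT.linHom.of_isSummand (IsSummand.inl.trans (.of_equiv' e))

end Dade

/-! ### The two groups of classes -/

section Groups

variable {p : ℕ} [Fact p.Prime] {k : Type u} [Field k] [CharP k p] [IsAlgClosed k] {G : Type v}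
  [Group G] [Finite G]

attribute [instance] CappedDadeModule.finite StronglyCappedModule.finite

omit [IsAlgClosed k] in
theorem CappedDadeModule.isGood (M : CappedDadeModule p k G) :
    IsGood p (linHom M.toRep.ρ M.toRep.ρ) := (isCappedDade_iff.1 M.isCappedDade).1

omit [IsAlgClosed k] in
theorem CappedDadeModule.not_isTraceProjective (M : CappedDadeModule p k G) :
    ¬ IsTraceProjective p M.toRep.ρ := (isCappedDade_iff.1 M.isCappedDade).2

omit [IsAlgClosed k] in
theorem compatible_iff (M N : CappedDadeModule p k G) :
    Compatible M N ↔ IsGood p (linHom M.toRep.ρ N.toRep.ρ) := by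
  rw [Compatible, isDade_iff, isGood_linHom_prod_iff M.isGood N.isGood]

theorem equivalence_compatible : Equivalence (Compatible (p := p) (k := k) (G := G)) where
  refl M := (compatible_iff M M).2 M.isGood
  symm {M N} h := (compatible_iff N M).2 ((compatible_iff M N).1 h).linHom_swap
  trans {M N L} h h' := (compatible_iff M L).2
    (.linHom_trans N.isGood N.not_isTraceProjective ((compatible_iff M N).1 h)
      ((compatible_iff N L).1 h'))

theorem isCappedDade_tprod (M N : CappedDadeModule p k G) :
    IsCappedDade p (M.toRep.ρ.tprod N.toRep.ρ) :=
  isCappedDade_iff.2 ⟨M.isGood.linHom_tprod N.isGood,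
    not_isTraceProjective_tprod M.isGood N.isGood M.not_isTraceProjective
      N.not_isTraceProjective⟩

/-- The capped Dade module underlying a strongly capped module. -/
def StronglyCappedModule.toCapped (M : StronglyCappedModule p k G) : CappedDadeModule p k G :=
  ⟨M.toRep, M.finite, M.isStronglyCapped.isCappedDade⟩

/-- Transitivity through a common cap gives one direction. For the other, goodness of `Hom(M, N)`
restricts to the caps, and caps with good `Hom` are isomorphic. -/
theorem sameCap_iff (M N : StronglyCappedModule p k G) :
    SameCap M N ↔ Compatible M.toCapped N.toCapped := by
  rw [compatible_iff]
  constructor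
  · rintro ⟨M₀, N₀, ⟨hM, hMv⟩, ⟨hN, hNv⟩, ⟨e⟩⟩
    have := hM.2.finite
    have := hN.2.finite
    have hg := M.toCapped.isGood.of_isSummand (.linHom hM.2 hM.2)
    have hT := (hasSylowVertex_iff hM.1).1 hMv
    exact .linHom_trans hg hT (M.toCapped.isGood.of_isSummand (.linHom .refl hM.2))
      (N.toCapped.isGood.of_isSummand (.linHom ((IsSummand.of_equiv e).trans hN.2) .refl))
  · intro h
    obtain ⟨M₀, hM, _, hMv, hMT, hMg, -⟩ :=
      exists_cap M.toCapped.isGood M.toCapped.not_isTraceProjective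
    obtain ⟨N₀, hN, _, hNv, hNT, hNg, -⟩ :=
      exists_cap N.toCapped.isGood N.toCapped.not_isTraceProjective
    exact ⟨M₀, N₀, ⟨hM, hMv⟩, ⟨hN, hNv⟩,
      hM.1.nonempty_equiv hN.1 hMg (h.of_isSummand (.linHom hM.2 hN.2)) hMT hNT⟩

theorem equivalence_sameCap : Equivalence (SameCap (p := p) (k := k) (G := G)) where
  refl M := (sameCap_iff M M).2 (equivalence_compatible.refl _)
  symm {M N} h := (sameCap_iff N M).2 (equivalence_compatible.symm ((sameCap_iff M N).1 h))
  trans {M N L} h h' := (sameCap_iff M L).2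
    (equivalence_compatible.trans ((sameCap_iff M N).1 h) ((sameCap_iff N L).1 h'))

omit [Fact p.Prime] [CharP k p] [IsAlgClosed k] in
theorem isStronglyCapped_tprod (M N : StronglyCappedModule p k G) :
    IsStronglyCapped p k G (M.toRep.ρ.tprod N.toRep.ρ) := by
  obtain ⟨hM, hM'⟩ := isStronglyCapped_iff.1 M.isStronglyCapped
  obtain ⟨hN, hN'⟩ := isStronglyCapped_iff.1 N.isStronglyCapped
  exact isStronglyCapped_iff.2 ⟨hM.linHom_tprod hN,
    (hM'.tprod hN').of_equiv linHomTensorEquiv.symm⟩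

/-- Every capped Dade module is compatible with a strongly capped module, its cap. -/
theorem CappedDadeModule.exists_stronglyCapped (M : CappedDadeModule p k G) :
    ∃ N : StronglyCappedModule p k G, Compatible N.toCapped M := by
  obtain ⟨U, hU, hf, -, hT, hg, -⟩ := exists_cap M.isGood M.not_isTraceProjective
  exact ⟨⟨U, hf, isStronglyCapped_iff.2 ⟨hg, hU.1.isTrivialPlusProjective hg hT⟩⟩,
    (compatible_iff _ _).2 (M.isGood.of_isSummand (.linHom hU.2 .refl))⟩

variable (p k G) in
/-- The setoid of compatibility. -/
def compatibleSetoid : Setoid (CappedDadeModule p k G) := ⟨_, equivalence_compatible⟩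

variable (p k G) in
/-- The trivial module as a capped Dade module. -/
def CappedDadeModule.one : CappedDadeModule p k G where
  toRep := Rep.of (trivial k G k)
  finite := inferInstanceAs (Module.Finite k k)
  isCappedDade := isCappedDade_iff.2
    ⟨isGood_trivial.of_equiv (linHomTrivial (.refl k k)).symm, not_isTraceProjective_trivial⟩

/-- The dual of a capped Dade module. -/
def CappedDadeModule.dual (M : CappedDadeModule p k G) : CappedDadeModule p k G where
  toRep := dualRep M.toRep.ρ
  finite := inferInstance
  isCappedDade := isCappedDade_iff.2
    ⟨M.isGood.linHom_dualRep, fun h => M.not_isTraceProjective h.of_dualRep⟩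

/-- The tensor product of capped Dade modules. -/
abbrev CappedDadeModule.mul (M N : CappedDadeModule p k G) : CappedDadeModule p k G :=
  M.tensor N (isCappedDade_tprod M N)

omit [IsAlgClosed k] in
theorem compatible_of_equiv {M N : CappedDadeModule p k G} (e : M.toRep.ρ.Equiv N.toRep.ρ) :
    Compatible M N :=
  (compatible_iff M N).2 (M.isGood.linHom_of_equiv e)

theorem compatible_mul {M M' N N' : CappedDadeModule p k G} (h : Compatible M M')
    (h' : Compatible N N') : Compatible (M.mul N) (M'.mul N') :=
  (compatible_iff _ _).2 (((compatible_iff _ _).1 h).linHom_tprod ((compatible_iff _ _).1 h'))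

omit [IsAlgClosed k] in
theorem compatible_dual {M N : CappedDadeModule p k G} (h : Compatible M N) :
    Compatible M.dual N.dual :=
  (compatible_iff _ _).2 ((compatible_iff _ _).1 h).linHom_dualRep

/-- Compatibility with `k` means that `Hom(k, M* ⊗ M) ≅ End(M)` is good, which is the Dade
condition. -/
theorem compatible_dual_mul_one (M : CappedDadeModule p k G) :
    Compatible (M.dual.mul M) (.one p k G) := by
  have : IsGood p (linHom (trivial k G k) ((dualRep M.toRep.ρ).ρ.tprod M.toRep.ρ)) :=
    (M.isGood.of_equiv dualTprodEquiv.symm).of_equiv (linHomTrivial (.refl k k)).symm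
  exact equivalence_compatible.symm ((compatible_iff _ _).2 this)

variable (p k G) in
/-- The abelian group of compatibility classes of capped Dade modules. -/
abbrev dadeGroup : AddCommGroup (Quotient (compatibleSetoid p k G)) :=
  let _ : Add (Quotient (compatibleSetoid p k G)) :=
    ⟨Quotient.map₂ CappedDadeModule.mul fun _ _ h _ _ h' => compatible_mul h h'⟩
  let _ : Zero (Quotient (compatibleSetoid p k G)) := ⟨Quotient.mk _ (.one p k G)⟩
  let _ : Neg (Quotient (compatibleSetoid p k G)) :=
    ⟨Quotient.map CappedDadeModule.dual fun _ _ h => compatible_dual h⟩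
  have hcomm : ∀ a b : Quotient (compatibleSetoid p k G), a + b = b + a := by
    rintro ⟨M⟩ ⟨N⟩
    exact Quotient.sound (compatible_of_equiv tprodComm)
  have hzero : ∀ a : Quotient (compatibleSetoid p k G), 0 + a = a := by
    rintro ⟨M⟩
    exact Quotient.sound (compatible_of_equiv (trivialTprod (.refl k k)))
  { add_assoc := by
      rintro ⟨M⟩ ⟨N⟩ ⟨L⟩
      exact Quotient.sound (compatible_of_equiv tprodAssoc)
    zero_add := hzero
    add_zero := fun a => (hcomm a 0).trans (hzero a)
    nsmul := nsmulRec
    zsmul := zsmulRec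
    neg_add_cancel := by
      rintro ⟨M⟩
      exact Quotient.sound (compatible_dual_mul_one M)
    add_comm := hcomm }

variable (p k G) in
/-- The setoid of having isomorphic caps. -/
def sameCapSetoid : Setoid (StronglyCappedModule p k G) := ⟨_, equivalence_sameCap⟩

variable (p k G) in
/-- Classes of strongly capped modules correspond to classes of capped Dade modules. -/
def capEquiv : Quotient (sameCapSetoid p k G) ≃ Quotient (compatibleSetoid p k G) :=
  .ofBijective (Quotient.map StronglyCappedModule.toCapped fun M N h => (sameCap_iff M N).1 h) (by
    constructor
    · rintro ⟨M⟩ ⟨N⟩ h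
      exact Quotient.sound ((sameCap_iff M N).2 (Quotient.exact h))
    · rintro ⟨M⟩
      obtain ⟨N, hN⟩ := M.exists_stronglyCapped
      exact ⟨Quotient.mk _ N, Quotient.sound hN⟩)

end Groups

end

end DadeModules

theorem theorem1p2 (p : ℕ) [Fact p.Prime] (k : Type u) [Field k] [IsAlgClosed k] [CharP k p]
    (G : Type v) [Group G] [Finite G] :
    -- compatibility is an equivalence relation on capped Dade modules, and these are
    -- closed under tensor products
    ∃ (hD : Equivalence (DadeModules.Compatible (p := p) (k := k) (G := G)))
      (tD : ∀ M N : DadeModules.CappedDadeModule p k G,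
        DadeModules.IsCappedDade p (M.toRep.ρ.tprod N.toRep.ρ))
      -- so are the strongly capped modules, with the relation of having isomorphic caps
      (hL : Equivalence (DadeModules.SameCap (p := p) (k := k) (G := G)))
      (tL : ∀ M N : DadeModules.StronglyCappedModule p k G,
        DadeModules.IsStronglyCapped p k G (M.toRep.ρ.tprod N.toRep.ρ))
      -- tensor product induces abelian group structures on both sets of classes
      (_ : AddCommGroup (Quotient (Setoid.mk _ hD)))
      (_ : AddCommGroup (Quotient (Setoid.mk _ hL))),
      (∀ M N : DadeModules.CappedDadeModule p k G,
        Quotient.mk (Setoid.mk _ hD) M + Quotient.mk (Setoid.mk _ hD) N =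
          Quotient.mk (Setoid.mk _ hD) (M.tensor N (tD M N))) ∧
      (∀ M N : DadeModules.StronglyCappedModule p k G,
        Quotient.mk (Setoid.mk _ hL) M + Quotient.mk (Setoid.mk _ hL) N =
          Quotient.mk (Setoid.mk _ hL) (M.tensor N (tL M N))) ∧
      -- and the two groups are isomorphic
      Nonempty (Quotient (Setoid.mk _ hD) ≃+ Quotient (Setoid.mk _ hL)) := by
  let A := DadeModules.dadeGroup p k G
  let e := DadeModules.capEquiv p k G
  -- Transport along `e` makes it an additive isomorphism; what remains is that transported addition
  -- is the tensor product, and `e` preserves tensor products definitionally.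
  let B : AddCommGroup (Quotient (DadeModules.sameCapSetoid p k G)) := e.addCommGroup
  refine ⟨DadeModules.equivalence_compatible, DadeModules.isCappedDade_tprod,
    DadeModules.equivalence_sameCap, DadeModules.isStronglyCapped_tprod, A, B,
    fun M N => rfl, fun M N => ?_, ⟨(e.addEquiv).symm⟩⟩
  exact e.symm_apply_eq.2 rfl
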